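/- **Theorem 1.1.** Assume the Continuum Hypothesis, $2^{\omega}=\omega_1$. Suppose that at least one of the following holds: 1. there exists an $\omega_1$-Kurepa tree, that is, a tree $T$ (a partially ordered set in which the strict predecessors of each element are well-ordered; the $\alpha$-th level consists of the elements whose set of strict predecessors has order type $\alpha$) of height $\omega_1$, all of whose levels are countable, and which has strictly more than $\omega_1$ cofinal branches (maximal chains that meet every level $\alpha<\omega_1$); 2. Todorčević's square principle $\square(\omega_2)$ holds, that is, there is a sequence $\langle c_\alpha \mid \alpha<\omega_2\rangle$ such that for each $\alpha<\omega_2$ the set $c_\alpha$ is closed and unbounded in $\alpha$ (for a successor $\alpha=\gamma+1$ this means closed with $\gamma\in c_\alpha$), $c_\beta=c_\alpha\cap\beta$ for every limit point $\beta<\alpha$ of $c_\alpha$, and there is no closed unbounded set $D\subseteq\omega_2$ such that $D\cap\alpha=c_\alpha$ for every limit point $\alpha<\omega_2$ of $D$. Then there are regular $T_1$ Lindelöf spaces $X_0,X_1$, in each of which every singleton is a $G_\delta$ set, such that $$e(X_0\times X_1)>2^{\omega},$$ where the extent $e(X)$ of a space $X$ is $\sup\{|C| : C\subseteq X \text{ is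 closed and discrete}\}$. -/

import Mathlib

open scoped Cardinal Ordinal

/-- The extent `e(X)`: the supremum of the cardinalities of the closed discrete subsets of `X`.
(The family is indexed by a type in the universe of `X`, hence bounded, so that the supremum
is a true least upper bound.) -/
noncomputable def extent (X : Type*) [TopologicalSpace X] : Cardinal :=
  ⨆ C : {C : Set X // IsClosed C ∧ DiscreteTopology C}, #C.1

/-- A partially ordered set is a (set-theoretic) tree if the strict predecessors of each of its
elements are well-ordered. -/
class IsSetTree (T : Type*) [PartialOrder T] : Prop where
  isWellOrder_Iio : ∀ t : T, IsWellOrder (Set.Iio t) (· < ·)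

/-- The height of a node `t` of a tree: the order type of the set of its strict predecessors. -/
noncomputable def treeHeight {T : Type*} [PartialOrder T] [IsSetTree T] (t : T) : Ordinal :=
  @Ordinal.type (Set.Iio t) (· < ·) (IsSetTree.isWellOrder_Iio t)

/-- The `α`-th level of a tree: the set of all its nodes of height `α`. -/
def treeLevel (T : Type*) [PartialOrder T] [IsSetTree T] (α : Ordinal) : Set T :=
  {t | treeHeight t = α}

/-- An `ω₁`-tree: a tree of height `ω₁` (a level is non-empty exactly if its index is
below `ω₁`) all of whose levels are countable. -/
structure IsOmegaOneTree (T : Type*) [PartialOrder T] [IsSetTree T] : Prop where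
  level_nonempty_iff : ∀ α : Ordinal, (treeLevel T α).Nonempty ↔ α < ω₁
  level_countable : ∀ α : Ordinal, (treeLevel T α).Countable

/-- A cofinal branch of an `ω₁`-tree: a maximal chain that meets every level below `ω₁`. -/
structure IsCofinalBranch {T : Type*} [PartialOrder T] [IsSetTree T] (B : Set T) : Prop where
  isMaxChain : IsMaxChain (· ≤ ·) B
  meets : ∀ α : Ordinal, α < ω₁ → (B ∩ treeLevel T α).Nonempty

/-- An `ω₁`-Kurepa tree: an `ω₁`-tree with strictly more than `ω₁` cofinal branches. -/
structure IsKurepaTree (T : Type*) [PartialOrder T] [IsSetTree T] : Prop where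
  isOmegaOneTree : IsOmegaOneTree T
  card_branches : ℵ₁ < #{B : Set T // IsCofinalBranch B}

/-- `c` is a closed unbounded subset of the ordinal `α = {β | β < α}`. -/
def IsClubIn (c : Set Ordinal) (α : Ordinal) : Prop :=
  c ⊆ Set.Iio α ∧ IsClub (Subtype.val ⁻¹' c : Set (Set.Iio α))

/-- Todorčević's square principle `□(κ)`. The limit points of a set of ordinals are its
accumulation points in the order topology. -/
def TodorcevicSquare (κ : Ordinal) : Prop :=
  ∃ c : Ordinal → Set Ordinal,
    (∀ α < κ, IsClubIn (c α) α) ∧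
    (∀ α < κ, ∀ β < α, AccPt β (Filter.principal (c α)) → c β = c α ∩ Set.Iio β) ∧
    ¬ ∃ D : Set Ordinal, IsClubIn D κ ∧
      ∀ α < κ, AccPt α (Filter.principal D) → D ∩ Set.Iio α = c α

/-! Each hypothesis yields a tree of sequences of natural numbers, indexed by initial segments of
`ω₂`, with no branch of length `ω₂`, with more than `ℵ₁` paths of uncountable cofinality, and thin:
on each level countably many sequences represent all nodes up to changes on a bounded part. A Kurepa
tree gives one by coding its countable levels with naturals; a square sequence gives one through the
step counts of walks (`IsSquareSeq.exists_walk_add`, `IsSquareSeq.not_exists_cofinal_branch`).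
`TreeData.exists_spaces` treats both at once.

In the space of such a tree every path `z` of uncountable cofinality carries a copy of the
Sorgenfrey line, while a maximal path of countable cofinality is a single point, admitted only if it
lies in a prescribed set `P`. Points leaving `z` at `α` are put near the label `φ z.1 α`. These
labels take each value only boundedly often, which makes singletons `Gδ`, and are constant just
below places of uncountable cofinality, which makes basic neighbourhoods clopen (`exists_rank_map`).

The second space uses the negated labels and the complement of `P`. Points leaving `z` at the same
late place in both factors are then put on the antidiagonal of the Sorgenfrey plane, which is closed
and discrete, so the pairs with both coordinates over the same `z`, label `0`, form a closed
discrete set. Over a path of countable cofinality there are no labels to separate with, but no such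
path is admitted in both spaces.

For the Lindelöf property, a cone needing uncountably many members of an open cover splits into two
such cones (`TreeData.exists_split`). Iterating gives a perfect set of paths of a common length `δ`
of countable cofinality. By thinness uncountably many of them are maximal, and under CH a Bernstein
construction makes both `P` and its complement meet every such set. A path so met is a point with a
neighbourhood inside one member of the cover, yet containing one of the bad cones. -/

/-! ### The first two uncountable cardinals as well-ordered types -/

/-- The well-ordered type of all countable ordinals. -/
abbrev OmegaOne : Type := (ℵ₁ : Cardinal.{0}).ord.ToType

/-- The well-ordered type of all ordinals of cardinality at most `ℵ₁`. -/
abbrev OmegaTwo : Type := (ℵ_ 2 : Cardinal.{0}).ord.ToType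

theorem succ_aleph_one : Order.succ (ℵ₁ : Cardinal.{0}) = ℵ_ 2 := by
  rw [Cardinal.succ_aleph, one_add_one_eq_two]

theorem countable_Iio_omegaOne (i : OmegaOne) : (Set.Iio i).Countable := by
  rw [← Cardinal.le_aleph0_iff_set_countable, ← Order.lt_succ_iff, Cardinal.succ_aleph0]
  simpa using Cardinal.mk_Iio_lt i

theorem mk_Iio_omegaTwo_le (i : OmegaTwo) : #(Set.Iio i) ≤ ℵ₁ := by
  rw [← Order.lt_succ_iff, succ_aleph_one]
  simpa using Cardinal.mk_Iio_lt i

theorem exists_forall_lt_of_mk_le (s : Set OmegaTwo) (hs : #s ≤ ℵ₁) : ∃ w, ∀ x ∈ s, x < w := by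
  by_contra! h
  have h1 : Order.cof OmegaTwo ≤ #s := Order.cof_le fun w => h w
  have h2 : Order.cof OmegaTwo = ℵ_ 2 := by
    rw [Ordinal.cof_toType, ← succ_aleph_one,
      (Cardinal.isRegular_succ (Cardinal.aleph0_le_aleph 1)).cof_ord]
  rw [h2, ← succ_aleph_one, Order.succ_le_iff] at h1
  exact h1.not_ge hs

theorem exists_forall_lt_of_countable {s : Set OmegaTwo} (hs : s.Countable) :
    ∃ w, ∀ x ∈ s, x < w :=
  exists_forall_lt_of_mk_le s
    ((Cardinal.le_aleph0_iff_set_countable.2 hs).trans (Cardinal.aleph0_le_aleph 1))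

/-- An element of a well-order has uncountable cofinality if every countable set of smaller
elements is bounded by a smaller element. -/
def UncCof {W : Type} [LinearOrder W] (γ : W) : Prop :=
  ∀ s : Set W, s.Countable → (∀ ξ ∈ s, ξ < γ) → ∃ η < γ, ∀ ξ ∈ s, ξ < η

theorem UncCof.exists_lt {W : Type} [LinearOrder W] {γ : W} (h : UncCof γ) : ∃ ξ, ξ < γ := by
  obtain ⟨η, hη, -⟩ := h ∅ Set.countable_empty (by simp)
  exact ⟨η, hη⟩

theorem UncCof.exists_between {W : Type} [LinearOrder W] {γ ξ : W} (h : UncCof γ) (hξ : ξ < γ) :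
    ∃ η, ξ < η ∧ η < γ := by
  obtain ⟨η, hη, h'⟩ := h {ξ} (Set.countable_singleton ξ) (by simpa using hξ)
  exact ⟨η, h' ξ rfl, hη⟩

theorem exists_of_not_uncCof {W : Type} [LinearOrder W] {γ : W} (h : ¬ UncCof γ) :
    ∃ s : Set W, s.Countable ∧ (∀ ξ ∈ s, ξ < γ) ∧ ∀ η < γ, ∃ ξ ∈ s, η ≤ ξ := by
  simpa [UncCof] using h

/-- A map into `ω₁` with bounded fibres which is constant to the left of each point of uncountable
cofinality. -/
theorem exists_rank_map (l : OmegaTwo) (hl : ∃ ξ, ξ < l) : ∃ ψ : OmegaTwo → OmegaOne,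
    (∀ ξ, ∃ b < l, ∀ α < l, ψ α = ξ → α ≤ b) ∧
    ∀ μ < l, UncCof μ → ∃ η < μ, ∀ α, η < α → α ≤ μ → ψ α = ψ μ := by
  classical
  obtain ⟨e⟩ : Nonempty (Set.Iio l ↪ OmegaOne) := by
    rw [← Cardinal.le_def]
    simpa using mk_Iio_omegaTwo_le l
  -- `ψ α` is the least code `e β` with `α ≤ β < l`. It is monotone below `l`, and `ψ α = e β`
  -- forces `α ≤ β`, so fibres are bounded.
  let A : OmegaTwo → Set OmegaOne := fun α => {ξ | ∃ β : Set.Iio l, α ≤ β.1 ∧ e β = ξ}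
  obtain ⟨ξ₀, hξ₀⟩ := hl
  let ψ : OmegaTwo → OmegaOne := fun α =>
    if h : (A α).Nonempty then wellFounded_lt.min (A α) h else e ⟨ξ₀, hξ₀⟩
  have hA : ∀ α < l, (A α).Nonempty := fun α h => ⟨_, ⟨α, h⟩, le_rfl, rfl⟩
  have hψ : ∀ α < l, ψ α ∈ A α := fun α h => by
    simp only [ψ, hA α h, dif_pos]
    exact WellFounded.min_mem _ _ _
  have hψle : ∀ α < l, ∀ ξ ∈ A α, ψ α ≤ ξ := fun α h ξ hξ => by
    simp only [ψ, hA α h, dif_pos]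
    exact WellFounded.min_le _ hξ
  refine ⟨ψ, fun ξ => ?_, fun μ hμ hunc => ?_⟩
  · by_cases h : ∃ β : Set.Iio l, e β = ξ
    · obtain ⟨β, rfl⟩ := h
      refine ⟨β.1, β.2, fun α hα h => ?_⟩
      obtain ⟨β', h1, h2⟩ := hψ α hα
      rw [h] at h2
      rwa [e.injective h2] at h1
    · refine ⟨ξ₀, hξ₀, fun α hα h' => ?_⟩
      obtain ⟨β', -, h2⟩ := hψ α hα
      exact absurd ⟨β', h2.trans h'⟩ h
  -- Only countably many codes lie below `ψ μ`, so uncountable cofinality bounds their places below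
  -- `μ`; beyond that bound nothing can make `ψ` smaller than `ψ μ`.
  · obtain ⟨η, hη, h⟩ := hunc {β | ∃ h : β < l, β < μ ∧ e ⟨β, h⟩ < ψ μ} (by
      have h1 : ((fun β : Set.Iio l => e β) ⁻¹' Set.Iio (ψ μ)).Countable :=
        (countable_Iio_omegaOne _).preimage e.injective
      refine (h1.image Subtype.val).mono ?_
      rintro β ⟨h, -, h'⟩
      exact ⟨⟨β, h⟩, h', rfl⟩) (fun β hβ => hβ.2.1)
    refine ⟨η, hη, fun α hα hαμ => le_antisymm ?_ ?_⟩
    · obtain ⟨β, h1, h2⟩ := hψ μ hμ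
      exact hψle α (hαμ.trans_lt hμ) _ ⟨β, hαμ.trans h1, h2⟩
    · obtain ⟨β, h1, h2⟩ := hψ α (hαμ.trans_lt hμ)
      rcases lt_or_ge β.1 μ with h3 | h3
      · rw [← h2]
        by_contra h4
        exact (hα.trans_le h1).not_ge (h β.1 ⟨β.2, h3, not_le.1 h4⟩).le
      · exact hψle μ hμ _ ⟨β, h3, h2⟩

/-! ### Splitting families of uncountable sets -/

/-- Under the bound `#ι ≤ ℵ₁`, uncountable sets indexed by `ι` can be split simultaneously. -/
theorem exists_splitting_set {ι α : Type} (hι : #ι ≤ ℵ₁) (S : ι → Set α)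
    (hS : ∀ i, ¬ (S i).Countable) :
    ∃ P : Set α, ∀ i, (S i ∩ P).Nonempty ∧ (S i \ P).Nonempty := by
  classical
  obtain ⟨e⟩ : Nonempty (ι ↪ OmegaOne) := by
    rw [← Cardinal.le_def]
    simpa using hι
  let f : ι → OmegaOne := e
  have hf : Function.Injective f := e.injective
  have hcount : ∀ i, {j | f j < f i}.Countable := fun i => (countable_Iio_omegaOne (f i)).preimage hf
  have hwf : WellFounded (fun j i : ι => f j < f i) := InvImage.wf f wellFounded_lt
  -- Bernstein recursion of length `ω₁`: only countably many pairs precede stage `i`, so two fresh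
  -- points of `S i` remain, one for `P` and one kept out.
  have step : ∀ (i : ι) (g : ∀ j, f j < f i → α × α),
      ∃ p : α × α, p.1 ∈ S i ∧ p.2 ∈ S i ∧ p.1 ≠ p.2 ∧
        ∀ j (h : f j < f i), p.1 ≠ (g j h).1 ∧ p.1 ≠ (g j h).2 ∧ p.2 ≠ (g j h).1 ∧
          p.2 ≠ (g j h).2 := by
    intro i g
    have : Countable {j // f j < f i} := (hcount i).to_subtype
    let B : Set α := (Set.range fun j : {j // f j < f i} => (g j.1 j.2).1) ∪
      Set.range fun j : {j // f j < f i} => (g j.1 j.2).2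
    have hB : B.Countable := (Set.countable_range _).union (Set.countable_range _)
    have h1 : (S i \ B).Nonempty := by
      rw [Set.nonempty_iff_ne_empty]
      intro h
      exact hS i (hB.mono (Set.sdiff_eq_empty.1 h))
    obtain ⟨a, ha, haB⟩ := h1
    have h2 : (S i \ insert a B).Nonempty := by
      rw [Set.nonempty_iff_ne_empty]
      intro h
      exact hS i ((hB.insert a).mono (Set.sdiff_eq_empty.1 h))
    obtain ⟨b, hb, hbB⟩ := h2
    refine ⟨(a, b), ha, hb, fun h => hbB (by simp [← show a = b from h]), fun j h => ?_⟩
    refine ⟨fun h' => haB ?_, fun h' => haB ?_, fun h' => hbB ?_, fun h' => hbB ?_⟩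
    · exact Or.inl ⟨⟨j, h⟩, h'.symm⟩
    · exact Or.inr ⟨⟨j, h⟩, h'.symm⟩
    · exact Or.inr (Or.inl ⟨⟨j, h⟩, h'.symm⟩)
    · exact Or.inr (Or.inr ⟨⟨j, h⟩, h'.symm⟩)
  choose p hp using step
  let q : ι → α × α := hwf.fix p
  have hq : ∀ i, q i = p i fun j _ => q j := fun i => hwf.fix_eq p i
  have hq' : ∀ i, (q i).1 ∈ S i ∧ (q i).2 ∈ S i ∧ (q i).1 ≠ (q i).2 ∧
      ∀ j (_ : f j < f i), (q i).1 ≠ (q j).1 ∧ (q i).1 ≠ (q j).2 ∧ (q i).2 ≠ (q j).1 ∧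
        (q i).2 ≠ (q j).2 := by
    intro i
    have := hp i fun j _ => q j
    rwa [← hq i] at this
  refine ⟨Set.range fun i => (q i).1, fun i => ⟨⟨_, (hq' i).1, i, rfl⟩, (q i).2, (hq' i).2.1, ?_⟩⟩
  rintro ⟨j, hj⟩
  rcases lt_trichotomy (f j) (f i) with h | h | h
  · exact ((hq' i).2.2.2 j h).2.2.1 hj.symm
  · exact (hq' i).2.2.1 (by rw [← hj, hf h])
  · exact ((hq' j).2.2.2 i h).2.1 hj

/-! ### The Sorgenfrey line -/

/-- The real line with the right half-open interval topology. -/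
def SorgenfreyLine : Type := ℝ

namespace SorgenfreyLine

/-- The identity map from the Sorgenfrey line to the reals. -/
def toReal : SorgenfreyLine → ℝ := fun x => x

/-- The identity map from the reals to the Sorgenfrey line. -/
def ofReal : ℝ → SorgenfreyLine := fun x => x

instance : TopologicalSpace SorgenfreyLine where
  IsOpen U := ∀ x ∈ U, ∃ e > x.toReal, ∀ y : SorgenfreyLine, x.toReal ≤ y.toReal → y.toReal < e → y ∈ U
  isOpen_univ := fun x _ => ⟨x.toReal + 1, by simp, fun _ _ _ => trivial⟩
  isOpen_inter := by
    rintro U V hU hV x ⟨hxU, hxV⟩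
    obtain ⟨e, he, h⟩ := hU x hxU
    obtain ⟨e', he', h'⟩ := hV x hxV
    exact ⟨min e e', lt_min he he', fun y h1 h2 =>
      ⟨h y h1 (h2.trans_le (min_le_left _ _)), h' y h1 (h2.trans_le (min_le_right _ _))⟩⟩
  isOpen_sUnion := by
    rintro 𝒰 h x ⟨U, hU, hx⟩
    obtain ⟨e, he, h'⟩ := h U hU x hx
    exact ⟨e, he, fun y h1 h2 => ⟨U, hU, h' y h1 h2⟩⟩

theorem isOpen_iff {U : Set SorgenfreyLine} : IsOpen U ↔ ∀ x ∈ U, ∃ e > x.toReal,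
    ∀ y : SorgenfreyLine, x.toReal ≤ y.toReal → y.toReal < e → y ∈ U := Iff.rfl

/-- The half-open interval `[a, b)`. -/
def Ico (a b : ℝ) : Set SorgenfreyLine := {x | a ≤ x.toReal ∧ x.toReal < b}

theorem isClopen_Ico (a b : ℝ) : IsClopen (Ico a b) := by
  refine ⟨⟨isOpen_iff.2 fun x hx => ?_⟩, isOpen_iff.2 fun x hx => ?_⟩
  · by_cases h : a ≤ x.toReal
    · have : b ≤ x.toReal := not_lt.1 fun h' => hx ⟨h, h'⟩
      exact ⟨x.toReal + 1, by simp, fun y h1 _ h2 => (h2.2.trans_le (this.trans h1)).false⟩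
    · exact ⟨a, not_le.1 h, fun y _ h1 h2 => (h1.trans_le h2.1).false⟩
  · exact ⟨b, hx.2, fun y h1 h2 => ⟨hx.1.trans h1, h2⟩⟩

theorem exists_Ico_subset {U : Set SorgenfreyLine} (hU : IsOpen U) {x : SorgenfreyLine}
    (hx : x ∈ U) : ∃ b > x.toReal, Ico x.toReal b ⊆ U := by
  obtain ⟨e, he, h⟩ := isOpen_iff.1 hU x hx
  exact ⟨e, he, fun y hy => h y hy.1 hy.2⟩

theorem exists_isClopen_subset {U : Set SorgenfreyLine} (hU : IsOpen U) {x : SorgenfreyLine}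
    (hx : x ∈ U) : ∃ V, IsClopen V ∧ x ∈ V ∧ V ⊆ U := by
  obtain ⟨b, hb, h⟩ := exists_Ico_subset hU hx
  exact ⟨_, isClopen_Ico _ _, ⟨le_rfl, hb⟩, h⟩

theorem isGδ_singleton (x : SorgenfreyLine) :
    ∃ O : ℕ → Set SorgenfreyLine, (∀ n, IsOpen (O n)) ∧ (∀ n, x ∈ O n) ∧ ∀ y, (∀ n, y ∈ O n) → y = x := by
  refine ⟨fun n => Ico x.toReal (x.toReal + 1 / (n + 1)), fun n => (isClopen_Ico _ _).2,
    fun n => ⟨le_rfl, by simp; positivity⟩, fun y hy => ?_⟩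
  have h0 : x.toReal ≤ y.toReal := (hy 0).1
  by_contra hne
  have h1 : x.toReal < y.toReal := lt_of_le_of_ne h0 fun h => hne h.symm
  obtain ⟨n, hn⟩ := exists_nat_one_div_lt (sub_pos.2 h1)
  have := (hy n).2
  linarith

theorem isClosed_singleton' (x : SorgenfreyLine) : IsOpen ({x}ᶜ : Set SorgenfreyLine) := by
  refine isOpen_iff.2 fun y hy => ?_
  rcases lt_or_ge y.toReal x.toReal with h | h
  · exact ⟨x.toReal, h, fun z _ h2 h3 => by rw [show z = x from h3] at h2; exact h2.false⟩
  · refine ⟨y.toReal + 1, by simp, fun z h1 _ h3 => hy ?_⟩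
    rw [show z = x from h3] at h1
    exact le_antisymm (α := ℝ) h1 h

instance : LindelofSpace SorgenfreyLine := by
  refine ⟨isLindelof_of_countable_subcover fun {ι} U hU hcov => ?_⟩
  have hcov' : ∀ x : ℝ, ∃ i, ofReal x ∈ U i := fun x => by simpa using hcov (Set.mem_univ (ofReal x))
  choose i hi using hcov'
  choose e he hsub using fun x => exists_Ico_subset (hU (i x)) (hi x)
  have he' : ∀ x : ℝ, x < e x := he
  obtain ⟨t, ht, htV⟩ := TopologicalSpace.isOpen_iUnion_countable (fun x : ℝ => Set.Ioo x (e x))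
    fun x => isOpen_Ioo
  set V := ⋃ x : ℝ, Set.Ioo x (e x) with hV
  have hC : (Vᶜ).Countable := by
    refine Set.PairwiseDisjoint.countable_of_Ioo (y := e) ?_ fun x _ => he' x
    intro x hx y hy hxy
    refine Set.disjoint_left.2 fun z hz hz' => ?_
    rcases lt_or_gt_of_ne hxy with h | h
    · exact hy (Set.mem_iUnion.2 ⟨x, h, hz'.1.trans hz.2⟩)
    · exact hx (Set.mem_iUnion.2 ⟨y, h, hz.1.trans hz'.2⟩)
  refine ⟨i '' (t ∪ Vᶜ), (ht.union hC).image _, fun x _ => ?_⟩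
  by_cases hx : x.toReal ∈ V
  · rw [← htV] at hx
    obtain ⟨y, hy, hxy⟩ := Set.mem_iUnion₂.1 hx
    exact Set.mem_iUnion₂.2 ⟨i y, ⟨y, Or.inl hy, rfl⟩, hsub y ⟨hxy.1.le, hxy.2⟩⟩
  · exact Set.mem_iUnion₂.2 ⟨i x.toReal, ⟨_, Or.inr hx, rfl⟩, hi x⟩

/-- The antidiagonal of the Sorgenfrey plane is closed and discrete. -/
theorem exists_antidiagonal_nhds (y z : SorgenfreyLine) : ∃ O O' : Set SorgenfreyLine,
    IsOpen O ∧ IsOpen O' ∧ y ∈ O ∧ z ∈ O' ∧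
      ∀ a b : ℝ, ofReal a ∈ O → ofReal (-a) ∈ O' → ofReal b ∈ O → ofReal (-b) ∈ O' → a = b := by
  let u : ℝ := y.toReal
  let v : ℝ := z.toReal
  have key : ∃ ε > 0, ∀ a b : ℝ, u ≤ a → a < u + ε → v ≤ -a → -a < v + ε →
      u ≤ b → b < u + ε → v ≤ -b → -b < v + ε → a = b := by
    -- Below the antidiagonal a small box misses it, on it a box meets it only in its corner, and
    -- above it every box misses it.
    rcases lt_trichotomy (u + v) 0 with h | h | h
    · exact ⟨-(u + v) / 2, by linarith, fun a b _ _ _ _ _ _ _ _ => by linarith⟩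
    · exact ⟨1, one_pos, fun a b _ _ _ _ _ _ _ _ => by linarith⟩
    · exact ⟨1, one_pos, fun a b _ _ _ _ _ _ _ _ => by linarith⟩
  obtain ⟨ε, hε, key⟩ := key
  refine ⟨Ico u (u + ε), Ico v (v + ε), (isClopen_Ico _ _).2, (isClopen_Ico _ _).2,
    ⟨le_rfl, by show u < u + ε; linarith⟩, ⟨le_rfl, by show v < v + ε; linarith⟩, ?_⟩
  rintro a b ⟨h1, h2⟩ ⟨h3, h4⟩ ⟨h5, h6⟩ ⟨h7, h8⟩
  exact key a b h1 h2 h3 h4 h5 h6 h7 h8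

end SorgenfreyLine

/-! ### Sequences of natural numbers indexed by initial segments of a well-order -/

/-- A sequence of natural numbers, given by its length and its values (those at or above the
length being irrelevant). -/
abbrev WSeq (W : Type) : Type := W × (W → ℕ)

/-- `w` leaves `z` exactly at `α`, which lies below the length of `z`. -/
def LeavesAt {W : Type} [LinearOrder W] (z w : WSeq W) (α : W) : Prop :=
  α < z.1 ∧ (∀ ξ < α, z.2 ξ = w.2 ξ) ∧ α ≤ w.1 ∧ (α = w.1 ∨ z.2 α ≠ w.2 α)

/-- `w` is a proper end-extension of `z`. -/
def ProperlyExtends {W : Type} [LinearOrder W] (z w : WSeq W) : Prop :=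
  z.1 < w.1 ∧ ∀ ξ < z.1, z.2 ξ = w.2 ξ

/-- The values of `z` vanish outside its length. -/
def VanishesOutside {W : Type} [LinearOrder W] (z : WSeq W) : Prop :=
  ∀ ξ, z.1 ≤ ξ → z.2 ξ = 0

section Sequences

variable {W : Type} [LinearOrder W] {z w : WSeq W} {α β : W}

theorem LeavesAt.unique (h : LeavesAt z w α) (h' : LeavesAt z w β) : α = β := by
  have key : ∀ {α β : W}, LeavesAt z w α → LeavesAt z w β → ¬ α < β := by
    intro α β h h' hlt
    rcases h.2.2.2 with h1 | h1
    · exact (hlt.trans_le h'.2.2.1).ne h1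
    · exact h1 (h'.2.1 α hlt)
  exact le_antisymm (not_lt.1 (key h' h)) (not_lt.1 (key h h'))

theorem not_leavesAt_self : ¬ LeavesAt z z α := fun h =>
  h.2.2.2.elim (fun h1 => h.1.ne h1) fun h1 => h1 rfl

theorem ProperlyExtends.not_leavesAt (h : ProperlyExtends z w) : ¬ LeavesAt z w α := fun h' =>
  h'.2.2.2.elim (fun h1 => (h'.1.trans h.1).ne h1) fun h1 => h1 (h.2 α h'.1)

theorem ProperlyExtends.leavesAt (h : ProperlyExtends z w) : LeavesAt w z z.1 :=
  ⟨h.1, fun ξ hξ => (h.2 ξ hξ).symm, le_rfl, Or.inl rfl⟩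

/-- Look at the least place below the length of `z` where `w` has ended or differs. All topological
case distinctions rest on this trichotomy. -/
theorem eq_or_leavesAt_or_properlyExtends [WellFoundedLT W] (hz : VanishesOutside z)
    (hw : VanishesOutside w) : w = z ∨ (∃ α, LeavesAt z w α) ∨ ProperlyExtends z w := by
  by_cases h : {ξ | ξ < z.1 ∧ (w.1 ≤ ξ ∨ z.2 ξ ≠ w.2 ξ)}.Nonempty
  · right; left
    obtain ⟨h1, h2⟩ := WellFounded.min_mem wellFounded_lt _ h
    set α := wellFounded_lt.min _ h
    have h3 : ∀ ξ < α, ξ < w.1 ∧ z.2 ξ = w.2 ξ := by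
      intro ξ hξ
      by_contra h4
      have h5 : ξ ∈ {ξ | ξ < z.1 ∧ (w.1 ≤ ξ ∨ z.2 ξ ≠ w.2 ξ)} := by
        refine ⟨hξ.trans h1, ?_⟩
        by_contra! h6
        exact h4 h6
      exact hξ.not_ge (WellFounded.min_le wellFounded_lt h5)
    have h4 : α ≤ w.1 := not_lt.1 fun h5 => (h3 _ h5).1.false
    exact ⟨α, h1, fun ξ hξ => (h3 ξ hξ).2, h4, h2.imp (fun h5 => le_antisymm h4 h5) id⟩
  · have h' : ∀ ξ < z.1, ξ < w.1 ∧ z.2 ξ = w.2 ξ := by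
      intro ξ hξ
      by_contra h4
      refine h ⟨ξ, hξ, ?_⟩
      by_contra! h6
      exact h4 h6
    have hle : z.1 ≤ w.1 := not_lt.1 fun h5 => (h' _ h5).1.false
    rcases hle.eq_or_lt with h1 | h1
    · left
      refine Prod.ext h1.symm (funext fun ξ => ?_)
      rcases lt_or_ge ξ z.1 with h2 | h2
      · exact (h' ξ h2).2.symm
      · rw [hz ξ h2, hw ξ (h1 ▸ h2)]
    · exact Or.inr (Or.inr ⟨h1, fun ξ hξ => (h' ξ hξ).2⟩)

end Sequences

/-! ### The space attached to a tree of sequences -/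

/-- A tree of sequences of natural numbers (`Ext β h` says that the restriction of `h` to the
elements below `β` is a node), together with the parameters from which a topological space is
built: a set `P` of sequences of countable cofinality, a base point of `Y`, and a map `φ` that tells
near which points of the fibre `{z} × Y` the points leaving `z` at a given place are put. -/
structure TreeData (W Y : Type) [LinearOrder W] where
  /-- The nodes of the tree. -/
  Ext : W → (W → ℕ) → Prop
  ext_congr : ∀ {β h h'}, Ext β h → (∀ ξ < β, h ξ = h' ξ) → Ext β h'
  ext_mono : ∀ {β γ h}, γ ≤ β → Ext β h → Ext γ h
  /-- The admitted sequences of countable cofinality. -/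
  P : Set (WSeq W)
  /-- The base point. -/
  y₀ : Y
  /-- The position at which the points leaving a sequence are put. -/
  φ : W → W → Y
  -- The first condition gives `Gδ` singletons, the second gives clopen basic neighbourhoods, and
  -- the third lets a path of countable cofinality attract everything that leaves it late.
  φ_bdd : ∀ l, UncCof l → ∀ y, ∃ b < l, ∀ α < l, φ l α = y → α ≤ b
  φ_const : ∀ l, ∀ μ < l, UncCof μ → ∃ η < μ, ∀ α, η < α → α ≤ μ → φ l α = φ l μ
  φ_base : ∀ l, ¬ UncCof l → ∀ α, φ l α = y₀

namespace TreeData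

variable {W Y : Type} [LinearOrder W] (D : TreeData W Y)

/-- The points of the space: paths of limit length through the tree, either of uncountable
cofinality and labelled by an arbitrary element of `Y`, or of countable cofinality, maximal and in
`D.P`. -/
def IsPoint (z : WSeq W) (y : Y) : Prop :=
  (∃ ξ, ξ < z.1) ∧ (∀ ξ < z.1, ∃ ξ' < z.1, ξ < ξ') ∧ VanishesOutside z ∧ (∀ β < z.1, D.Ext β z.2) ∧
    (UncCof z.1 ∨ (¬ UncCof z.1 ∧ ¬ D.Ext z.1 z.2 ∧ z ∈ D.P ∧ y = D.y₀))

/-- The space attached to `D`. -/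
def Space : Type := {p : WSeq W × Y // D.IsPoint p.1 p.2}

variable {D}

/-- The sequence of a point. -/
def Space.seq (p : D.Space) : WSeq W := p.1.1

/-- The label of a point. -/
def Space.lab (p : D.Space) : Y := p.1.2

theorem Space.exists_lt (p : D.Space) : ∃ ξ, ξ < p.seq.1 := p.2.1

theorem Space.vanishesOutside (p : D.Space) : VanishesOutside p.seq := p.2.2.2.1

theorem Space.ext_of_lt (p : D.Space) {β : W} (h : β < p.seq.1) : D.Ext β p.seq.2 :=
  p.2.2.2.2.1 β h

theorem Space.ext_iff {p q : D.Space} : p = q ↔ p.seq = q.seq ∧ p.lab = q.lab := by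
  constructor
  · rintro rfl; exact ⟨rfl, rfl⟩
  · rintro ⟨h1, h2⟩; exact Subtype.ext (Prod.ext h1 h2)

theorem Space.uncCof_of_ext (p : D.Space) (h : D.Ext p.seq.1 p.seq.2) : UncCof p.seq.1 :=
  p.2.2.2.2.2.elim id fun h' => absurd h h'.2.1

theorem Space.lab_eq (p : D.Space) (h : ¬ UncCof p.seq.1) : p.lab = D.y₀ :=
  p.2.2.2.2.2.elim (fun h' => absurd h' h) fun h' => h'.2.2.2

theorem Space.mem_P (p : D.Space) (h : ¬ UncCof p.seq.1) : p.seq ∈ D.P :=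
  p.2.2.2.2.2.elim (fun h' => absurd h' h) fun h' => h'.2.2.1

/-- A path of countable cofinality is admitted only when it is not a node, whereas every proper
initial segment of a point is one. -/
theorem Space.not_properlyExtends (p q : D.Space) (h : ¬ UncCof p.seq.1) :
    ¬ ProperlyExtends p.seq q.seq := fun h' =>
  h (p.uncCof_of_ext (D.ext_congr (q.ext_of_lt h'.1) fun ξ hξ => (h'.2 ξ hξ).symm))

variable (D) in
/-- The basic neighbourhoods. -/
def nbd (z : WSeq W) (O : Set Y) (η : W) : Set D.Space :=
  {w | (w.seq = z ∧ w.lab ∈ O) ∨ ∃ α, η < α ∧ LeavesAt z w.seq α ∧ D.φ z.1 α ∈ O}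

theorem nbd_mono {z : WSeq W} {O O' : Set Y} {η η' : W} (hO : O ⊆ O') (hη : η' ≤ η) :
    D.nbd z O η ⊆ D.nbd z O' η' := by
  rintro w (⟨h1, h2⟩ | ⟨α, h1, h2, h3⟩)
  · exact Or.inl ⟨h1, hO h2⟩
  · exact Or.inr ⟨α, hη.trans_lt h1, h2, hO h3⟩

theorem mem_nbd_self {p : D.Space} {O : Set Y} {η : W} (h : p.lab ∈ O) : p ∈ D.nbd p.seq O η :=
  Or.inl ⟨rfl, h⟩

/-- Being a node where some point leaves a given path is stable under small perturbations. -/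
theorem exists_leavesAt_of_mem_nbd {z : WSeq W} (hz : ∀ β < z.1, D.Ext β z.2) {p : D.Space}
    {α : W} (h : LeavesAt z p.seq α) (η₀ : W) :
    ∃ η < p.seq.1, ∀ q ∈ D.nbd p.seq Set.univ η, ∃ α', LeavesAt z q.seq α' ∧
      D.φ z.1 α' = D.φ z.1 α ∧ α' ≤ α ∧ (η₀ < α → η₀ < α') := by
  rcases h.2.2.1.eq_or_lt with h1 | h1
  -- Here `p` ends exactly at `α`, so it is a node and has uncountable cofinality. A nearby point
  -- may leave `z` slightly before `α`, where `φ` still has the same value.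
  · have hunc : UncCof α := by
      rw [h1]
      refine p.uncCof_of_ext ?_
      rw [← h1]
      exact D.ext_congr (hz α h.1) h.2.1
    obtain ⟨η₁, hη₁, hc⟩ := D.φ_const z.1 α h.1 hunc
    refine ⟨if η₀ < α then max η₀ η₁ else η₁, ?_, ?_⟩
    · rw [← h1]; split_ifs with h2
      · exact max_lt h2 hη₁
      · exact hη₁
    · rintro q (⟨hq, -⟩ | ⟨β, hβ, hq, -⟩)
      · exact ⟨α, by rwa [hq], rfl, le_rfl, id⟩
      · have hβα : β < α := h1 ▸ hq.1
        have hη₁β : η₁ < β := by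
          split_ifs at hβ with h2
          · exact (le_max_right _ _).trans_lt hβ
          · exact hβ
        refine ⟨β, ⟨hβα.trans h.1, fun ξ hξ => ?_, hq.2.2.1, ?_⟩, hc β hη₁β hβα.le, hβα.le,
          fun h2 => ?_⟩
        · rw [h.2.1 ξ (hξ.trans hβα), hq.2.1 ξ hξ]
        · rw [h.2.1 β hβα]; exact hq.2.2.2
        · rw [if_pos h2] at hβ
          exact (le_max_left _ _).trans_lt hβ
  · have h2 : z.2 α ≠ p.seq.2 α := h.2.2.2.resolve_left h1.ne
    refine ⟨α, h1, ?_⟩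
    rintro q (⟨hq, -⟩ | ⟨β, hβ, hq, -⟩)
    · exact ⟨α, by rwa [hq], rfl, le_rfl, id⟩
    · refine ⟨α, ⟨h.1, fun ξ hξ => ?_, hβ.le.trans hq.2.2.1, Or.inr ?_⟩, rfl, le_rfl, id⟩
      · rw [h.2.1 ξ hξ, hq.2.1 ξ (hξ.trans hβ)]
      · rwa [← hq.2.1 α hβ]

theorem properlyExtends_of_mem_nbd {z : WSeq W} {p q : D.Space} (h : ProperlyExtends z p.seq)
    (hq : q ∈ D.nbd p.seq Set.univ z.1) : ProperlyExtends z q.seq := by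
  rcases hq with ⟨hq, -⟩ | ⟨β, hβ, hq, -⟩
  · rwa [hq]
  · exact ⟨hβ.trans_le hq.2.2.1, fun ξ hξ => by rw [h.2 ξ hξ, hq.2.1 ξ (hξ.trans hβ)]⟩

/-! ### Topology of the space and its separation properties -/

variable [TopologicalSpace Y]

instance : TopologicalSpace D.Space where
  IsOpen U := ∀ p ∈ U, ∃ O, IsOpen O ∧ p.lab ∈ O ∧ ∃ η < p.seq.1, D.nbd p.seq O η ⊆ U
  isOpen_univ := fun p _ =>
    ⟨Set.univ, isOpen_univ, trivial, p.exists_lt.imp fun _ h => ⟨h, Set.subset_univ _⟩⟩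
  isOpen_inter := by
    rintro U V hU hV p ⟨hpU, hpV⟩
    obtain ⟨O, hO, hp, η, hη, h⟩ := hU p hpU
    obtain ⟨O', hO', hp', η', hη', h'⟩ := hV p hpV
    exact ⟨O ∩ O', hO.inter hO', ⟨hp, hp'⟩, max η η', max_lt hη hη', Set.subset_inter
      ((nbd_mono Set.inter_subset_left (le_max_left _ _)).trans h)
      ((nbd_mono Set.inter_subset_right (le_max_right _ _)).trans h')⟩
  isOpen_sUnion := by
    rintro 𝒰 h p ⟨U, hU, hp⟩
    obtain ⟨O, hO, hpO, η, hη, h'⟩ := h U hU p hp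
    exact ⟨O, hO, hpO, η, hη, h'.trans (Set.subset_sUnion_of_mem hU)⟩

theorem isOpen_iff {U : Set D.Space} : IsOpen U ↔
    ∀ p ∈ U, ∃ O, IsOpen O ∧ p.lab ∈ O ∧ ∃ η < p.seq.1, D.nbd p.seq O η ⊆ U := Iff.rfl

theorem isOpen_nbd {z : WSeq W} (hz : ∀ β < z.1, D.Ext β z.2) {O : Set Y} (hO : IsOpen O) {η : W}
    (hη : η < z.1) : IsOpen (D.nbd z O η) := by
  refine isOpen_iff.2 fun p hp => ?_
  rcases hp with ⟨h1, h2⟩ | ⟨α, h1, h2, h3⟩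
  · exact ⟨O, hO, h2, η, by rwa [h1], by rw [h1]⟩
  · obtain ⟨η', hη', h⟩ := exists_leavesAt_of_mem_nbd hz h2 η
    refine ⟨Set.univ, isOpen_univ, trivial, η', hη', fun q hq => ?_⟩
    obtain ⟨α', h4, h5, -, h6⟩ := h q hq
    exact Or.inr ⟨α', h6 h1, h4, h5 ▸ h3⟩

theorem isOpen_nbd_seq (p : D.Space) {O : Set Y} (hO : IsOpen O) {η : W} (hη : η < p.seq.1) :
    IsOpen (D.nbd p.seq O η) :=
  isOpen_nbd (fun _ h => p.ext_of_lt h) hO hη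

/-- With uncountable cofinality, shrinking the labels to one value leaves only departures in a
single fibre of `φ`, and these are bounded. Otherwise a countable cofinal set of bounds excludes
every departure. -/
theorem isGδ_singleton (hY : ∀ y : Y, ∃ O : ℕ → Set Y, (∀ n, IsOpen (O n)) ∧ (∀ n, y ∈ O n) ∧
    ∀ y', (∀ n, y' ∈ O n) → y' = y) (p : D.Space) : IsGδ ({p} : Set D.Space) := by
  by_cases hunc : UncCof p.seq.1
  · obtain ⟨O, hO, hpO, h⟩ := hY p.lab
    obtain ⟨b, hb, hb'⟩ := D.φ_bdd _ hunc p.lab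
    have : ({p} : Set D.Space) = ⋂ n, D.nbd p.seq (O n) b := by
      refine Set.Subset.antisymm ?_ fun q hq => ?_
      · rintro _ rfl
        exact Set.mem_iInter.2 fun n => mem_nbd_self (hpO n)
      · have hq' := Set.mem_iInter.1 hq
        by_cases hs : q.seq = p.seq
        · refine Space.ext_iff.2 ⟨hs, h _ fun n => ?_⟩
          rcases hq' n with h1 | ⟨α, -, h1, -⟩
          · exact h1.2
          · rw [hs] at h1; exact absurd h1 not_leavesAt_self
        · exfalso
          have h2 : ∀ n, ∃ α, b < α ∧ LeavesAt p.seq q.seq α ∧ D.φ p.seq.1 α ∈ O n :=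
            fun n => (hq' n).resolve_left fun h3 => hs h3.1
          obtain ⟨α, h3, h4, -⟩ := h2 0
          refine h3.not_ge (hb' α h4.1 (h _ fun n => ?_))
          obtain ⟨β, -, h5, h6⟩ := h2 n
          rwa [h4.unique h5]
    rw [this]
    exact .iInter_of_isOpen fun n => isOpen_nbd_seq p (hO n) hb
  · obtain ⟨s, hs, hsl, hcof⟩ := exists_of_not_uncCof hunc
    have : ({p} : Set D.Space) = ⋂ α ∈ s, D.nbd p.seq Set.univ α := by
      refine Set.Subset.antisymm ?_ fun q hq => ?_
      · rintro _ rfl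
        exact Set.mem_iInter₂.2 fun n _ => mem_nbd_self trivial
      · have hq' := Set.mem_iInter₂.1 hq
        have hs : q.seq = p.seq := by
          by_contra hne
          obtain ⟨ξ, hξ⟩ := p.exists_lt
          obtain ⟨α, hα, -⟩ := hcof ξ hξ
          obtain ⟨β, -, hβ, -⟩ := (hq' α hα).resolve_left fun h3 => hne h3.1
          obtain ⟨α', hα', hle⟩ := hcof β hβ.1
          obtain ⟨β', hlt, hβ', -⟩ := (hq' α' hα').resolve_left fun h3 => hne h3.1
          rw [hβ.unique hβ'] at hle
          exact hlt.not_ge hle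
        refine Space.ext_iff.2 ⟨hs, ?_⟩
        rw [p.lab_eq hunc, q.lab_eq (by rwa [hs])]
    rw [this]
    exact .biInter_of_isOpen hs fun α hα => isOpen_nbd_seq p isOpen_univ (hsl α hα)

variable [WellFoundedLT W]

/-- For each outcome of the trichotomy, points near an outside point stand in the same relation to
`p`; if they leave `p`, they do so with the same value of `φ` and no later. -/
theorem isClosed_nbd (p : D.Space) {O : Set Y} (hO : IsClosed O) {η : W} (hη : η < p.seq.1) :
    IsClosed (D.nbd p.seq O η) := by
  refine ⟨isOpen_iff.2 fun q hq => ?_⟩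
  rcases eq_or_leavesAt_or_properlyExtends p.vanishesOutside q.vanishesOutside with h | ⟨α, h⟩ | h
  · have hq' : q.lab ∈ Oᶜ := fun h' => hq (Or.inl ⟨h, h'⟩)
    refine ⟨Oᶜ, hO.isOpen_compl, hq', η, by rwa [h], ?_⟩
    rw [h]
    rintro r (⟨h1, h2⟩ | ⟨β, h1, h2, h3⟩) (⟨h1', h2'⟩ | ⟨β', h1', h2', h3'⟩)
    · exact h2 h2'
    · rw [h1] at h2'; exact not_leavesAt_self h2'
    · rw [h1'] at h2; exact not_leavesAt_self h2
    · rw [h2.unique h2'] at h3; exact h3 h3'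
  · obtain ⟨η', hη', h'⟩ := exists_leavesAt_of_mem_nbd (fun _ h => p.ext_of_lt h) h η
    refine ⟨Set.univ, isOpen_univ, trivial, η', hη', fun r hr => ?_⟩
    obtain ⟨α', h4, h5, h6, -⟩ := h' r hr
    rintro (⟨h1', h2'⟩ | ⟨β', h1', h2', h3'⟩)
    · rw [h1'] at h4; exact not_leavesAt_self h4
    · rw [h2'.unique h4] at h1' h3'
      exact hq (Or.inr ⟨α, h1'.trans_le h6, h, h5 ▸ h3'⟩)
  · refine ⟨Set.univ, isOpen_univ, trivial, p.seq.1, h.1, fun r hr => ?_⟩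
    have h1 := properlyExtends_of_mem_nbd h hr
    rintro (⟨h1', h2'⟩ | ⟨β', h1', h2', h3'⟩)
    · exact (h1' ▸ h1).1.false
    · exact h1.not_leavesAt h2'

theorem regularSpace (hY : ∀ (U : Set Y) (y : Y), IsOpen U → y ∈ U →
    ∃ V, IsClopen V ∧ y ∈ V ∧ V ⊆ U) : RegularSpace D.Space := by
  refine .of_exists_mem_nhds_isClosed_subset fun p s hs => ?_
  obtain ⟨U, hUs, hU, hp⟩ := mem_nhds_iff.1 hs
  obtain ⟨O, hO, hpO, η, hη, h⟩ := isOpen_iff.1 hU p hp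
  obtain ⟨V, hV, hpV, hVO⟩ := hY O p.lab hO hpO
  exact ⟨D.nbd p.seq V η, (isOpen_nbd_seq p hV.2 hη).mem_nhds (mem_nbd_self hpV),
    isClosed_nbd p hV.1 hη, ((nbd_mono hVO le_rfl).trans h).trans hUs⟩

theorem t1Space [T1Space Y] : T1Space D.Space := by
  refine ⟨fun p => ⟨isOpen_iff.2 fun q hq => ?_⟩⟩
  rcases eq_or_leavesAt_or_properlyExtends p.vanishesOutside q.vanishesOutside with h | ⟨α, h⟩ | h
  · have hne : q.lab ∈ ({p.lab}ᶜ : Set Y) := fun h' => hq (Space.ext_iff.2 ⟨h, h'⟩)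
    obtain ⟨η, hη⟩ := q.exists_lt
    refine ⟨_, isOpen_compl_singleton, hne, η, hη, ?_⟩
    rintro r hr rfl
    rcases hr with ⟨h1, h2⟩ | ⟨β, h1, h2, h3⟩
    · exact h2 rfl
    · rw [h] at h2; exact not_leavesAt_self h2
  · obtain ⟨η', hη', h'⟩ := exists_leavesAt_of_mem_nbd (fun _ h => p.ext_of_lt h) h α
    refine ⟨Set.univ, isOpen_univ, trivial, η', hη', ?_⟩
    rintro r hr rfl
    obtain ⟨α', h4, -⟩ := h' r hr
    exact not_leavesAt_self h4
  · refine ⟨Set.univ, isOpen_univ, trivial, p.seq.1, h.1, ?_⟩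
    rintro r hr rfl
    exact (properlyExtends_of_mem_nbd h hr).1.false

end TreeData

/-! ### Countably covered sets -/

/-- `A` is covered by countably many members of the family `U`. -/
def CountablyCovered {X ι : Type*} (U : ι → Set X) (A : Set X) : Prop :=
  ∃ t : Set ι, t.Countable ∧ A ⊆ ⋃ i ∈ t, U i

namespace CountablyCovered

variable {X ι : Type*} {U : ι → Set X} {A B : Set X}

theorem mono (h : CountablyCovered U B) (hAB : A ⊆ B) : CountablyCovered U A :=
  h.imp fun _ h => ⟨h.1, hAB.trans h.2⟩

theorem of_subset {i : ι} (h : A ⊆ U i) : CountablyCovered U A :=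
  ⟨{i}, Set.countable_singleton i, by simpa using h⟩

theorem empty : CountablyCovered U ∅ := ⟨∅, Set.countable_empty, Set.empty_subset _⟩

theorem biUnion {κ : Type*} {s : Set κ} (hs : s.Countable) {A : κ → Set X}
    (h : ∀ k ∈ s, CountablyCovered U (A k)) : CountablyCovered U (⋃ k ∈ s, A k) := by
  choose! t ht hA using h
  refine ⟨⋃ k ∈ s, t k, hs.biUnion ht, Set.iUnion₂_subset fun k hk x hx => ?_⟩
  obtain ⟨i, hi, hxi⟩ := Set.mem_iUnion₂.1 (hA k hk hx)
  exact Set.mem_iUnion₂.2 ⟨i, Set.mem_iUnion₂.2 ⟨k, hk, hi⟩, hxi⟩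

theorem iUnion {κ : Type*} [Countable κ] {A : κ → Set X}
    (h : ∀ k, CountablyCovered U (A k)) : CountablyCovered U (⋃ k, A k) := by
  have := biUnion (Set.countable_univ (α := κ)) fun k _ => h k
  simpa using this

theorem union (hA : CountablyCovered U A) (hB : CountablyCovered U B) :
    CountablyCovered U (A ∪ B) := by
  rw [Set.union_eq_iUnion]
  exact iUnion fun b => by cases b <;> assumption

end CountablyCovered

/-! ### Cones, and the splitting of cones that are not countably covered -/

namespace TreeData

variable {W Y : Type} [LinearOrder W] {D : TreeData W Y}

variable (D) in
/-- The points that agree with `h` up to and including `η`. -/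
def cone (h : W → ℕ) (η : W) : Set D.Space := {p | η < p.seq.1 ∧ ∀ ξ ≤ η, p.seq.2 ξ = h ξ}

variable (D) in
/-- The points that agree with `h` below `γ`. -/
def openCone (h : W → ℕ) (γ : W) : Set D.Space := {p | γ ≤ p.seq.1 ∧ ∀ ξ < γ, p.seq.2 ξ = h ξ}

theorem cone_anti {h : W → ℕ} {η η' : W} (hη : η ≤ η') : D.cone h η' ⊆ D.cone h η :=
  fun _ hp => ⟨hη.trans_lt hp.1, fun ξ hξ => hp.2 ξ (hξ.trans hη)⟩

theorem cone_congr {h h' : W → ℕ} {η : W} (hh : ∀ ξ ≤ η, h ξ = h' ξ) :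
    D.cone h η = D.cone h' η := by
  ext p
  exact and_congr_right fun _ => forall₂_congr fun ξ hξ => by rw [hh ξ hξ]

theorem ext_of_cone_nonempty {h : W → ℕ} {η : W} (hne : (D.cone h η).Nonempty) : D.Ext η h := by
  obtain ⟨p, h1, h2⟩ := hne
  exact D.ext_congr (p.ext_of_lt h1) fun ξ hξ => h2 ξ hξ.le

/-- A point through `h` below `γ` either ends at `γ` or takes one of countably many values there;
this is where countable branching enters. -/
theorem openCone_subset (h : W → ℕ) (γ : W) :
    D.openCone h γ ⊆ {p | p.seq = (γ, fun ξ => if ξ < γ then h ξ else 0)} ∪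
      ⋃ n : ℕ, D.cone (Function.update h γ n) γ := by
  rintro p ⟨h1, h2⟩
  rcases h1.eq_or_lt with h3 | h3
  · left
    refine Prod.ext h3.symm (funext fun ξ => ?_)
    show p.seq.2 ξ = if ξ < γ then h ξ else 0
    split_ifs with h4
    · exact h2 ξ h4
    · exact p.vanishesOutside ξ (by rw [← h3]; exact not_lt.1 h4)
  · right
    refine Set.mem_iUnion.2 ⟨p.seq.2 γ, h3, fun ξ hξ => ?_⟩
    rcases hξ.eq_or_lt with rfl | h4
    · simp
    · rw [Function.update_of_ne h4.ne, h2 ξ h4]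

variable [TopologicalSpace Y] {ι : Type*} {U : ι → Set D.Space}

/-- If `z` has uncountable cofinality then all points that leave `z` late enough are covered by
countably many members of an open cover. -/
theorem exists_countablyCovered_near [LindelofSpace Y] (hU : ∀ i, IsOpen (U i))
    (hcov : ∀ p, ∃ i, p ∈ U i) {z : WSeq W} (hz : ∀ y, D.IsPoint z y) (hunc : UncCof z.1) :
    ∃ η < z.1, CountablyCovered U {p | p.seq = z ∨ ∃ α, η < α ∧ LeavesAt z p.seq α} := by
  have h1 : ∀ y : Y, ∃ i, ∃ O, IsOpen O ∧ y ∈ O ∧ ∃ η < z.1, D.nbd z O η ⊆ U i := by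
    intro y
    obtain ⟨i, hi⟩ := hcov ⟨(z, y), hz y⟩
    exact ⟨i, isOpen_iff.1 (hU i) _ hi⟩
  choose i O hO hyO e he hsub using h1
  obtain ⟨t, ht, htO⟩ := isLindelof_univ.elim_countable_subcover O hO
    fun y _ => Set.mem_iUnion.2 ⟨y, hyO y⟩
  -- Countably many neighbourhoods cover the fibre, and uncountable cofinality provides one bound
  -- valid for all of them.
  obtain ⟨η, hη, hlt⟩ := hunc (e '' t) (ht.image e) (by rintro _ ⟨y, -, rfl⟩; exact he y)
  refine ⟨η, hη, i '' t, ht.image i, ?_⟩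
  rintro p (hp | ⟨α, hα, hp⟩)
  · obtain ⟨y, hy, hpy⟩ := Set.mem_iUnion₂.1 (htO (Set.mem_univ p.lab))
    exact Set.mem_iUnion₂.2 ⟨i y, ⟨y, hy, rfl⟩, hsub y (Or.inl ⟨hp, hpy⟩)⟩
  · obtain ⟨y, hy, hpy⟩ := Set.mem_iUnion₂.1 (htO (Set.mem_univ (D.φ z.1 α)))
    exact Set.mem_iUnion₂.2 ⟨i y, ⟨y, hy, rfl⟩,
      hsub y (Or.inr ⟨α, (hlt _ ⟨y, hy, rfl⟩).trans hα, hp, hpy⟩)⟩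

theorem countablyCovered_fiber [LindelofSpace Y] (hU : ∀ i, IsOpen (U i))
    (hcov : ∀ p, ∃ i, p ∈ U i) (z : WSeq W) : CountablyCovered U {p | p.seq = z} := by
  by_cases hne : ∃ p : D.Space, p.seq = z
  · obtain ⟨p, rfl⟩ := hne
    by_cases hunc : UncCof p.seq.1
    · have hz : ∀ y, D.IsPoint p.seq y := fun y =>
        ⟨p.2.1, p.2.2.1, p.2.2.2.1, p.2.2.2.2.1, Or.inl hunc⟩
      obtain ⟨η, -, h⟩ := exists_countablyCovered_near hU hcov hz hunc
      exact h.mono fun q hq => Or.inl hq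
    · obtain ⟨i, hi⟩ := hcov p
      refine CountablyCovered.of_subset (i := i) fun q hq => ?_
      have : q = p := Space.ext_iff.2 ⟨hq, by
        rw [p.lab_eq hunc, q.lab_eq (by rwa [show q.seq = p.seq from hq])]⟩
      rwa [this]
  · have : {p : D.Space | p.seq = z} = ∅ := Set.eq_empty_of_forall_notMem fun p hp => hne ⟨p, hp⟩
    rw [this]
    exact CountablyCovered.empty

variable [WellFoundedLT W]

/-- A cone that is not countably covered contains two disjoint such cones. -/
theorem exists_split [LindelofSpace Y] (hbranch : ¬ ∃ h, ∀ β, D.Ext β h) (hU : ∀ i, IsOpen (U i))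
    (hcov : ∀ p, ∃ i, p ∈ U i) {h : W → ℕ} {β : W} (hh : ¬ CountablyCovered U (D.cone h β)) :
    ∃ η, ∃ g : Bool → W → ℕ, (∀ b, ∀ ξ ≤ β, g b ξ = h ξ) ∧
      (∀ b, ¬ CountablyCovered U (D.cone (g b) η)) ∧ ∃ ξ ≤ η, g true ξ ≠ g false ξ := by
  classical
  by_contra hcon
  have huniq : ∀ η (h₁ h₂ : W → ℕ), (∀ ξ ≤ β, h₁ ξ = h ξ) → (∀ ξ ≤ β, h₂ ξ = h ξ) →
      ¬ CountablyCovered U (D.cone h₁ η) → ¬ CountablyCovered U (D.cone h₂ η) →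
      ∀ ξ ≤ η, h₁ ξ = h₂ ξ := by
    intro η h₁ h₂ e₁ e₂ n₁ n₂ ξ hξ
    by_contra hne
    exact hcon ⟨η, fun b => cond b h₁ h₂, by rintro (_ | _) <;> assumption,
      by rintro (_ | _) <;> assumption, ξ, hξ, hne⟩
  -- Without a split, the bad cones at each height follow a single path `x`; `Z η` says that one
  -- still exists at height `η`.
  let Z : W → Prop := fun η => ∃ h', (∀ ξ ≤ β, h' ξ = h ξ) ∧ ¬ CountablyCovered U (D.cone h' η)
  have hZβ : Z β := ⟨h, fun _ _ => rfl, hh⟩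
  have hZmono : ∀ {η η'}, η' ≤ η → Z η → Z η' := fun hle ⟨h', h1, h2⟩ =>
    ⟨h', h1, fun h3 => h2 (h3.mono (cone_anti hle))⟩
  choose! g hgβ hgn using (fun η (hη : Z η) => hη)
  let x : W → ℕ := fun ξ => if Z ξ then g ξ ξ else 0
  have F1 : ∀ {h' η}, (∀ ξ ≤ β, h' ξ = h ξ) → ¬ CountablyCovered U (D.cone h' η) →
      ∀ ξ ≤ η, h' ξ = x ξ := by
    intro h' η h1 h2 ξ hξ
    have h3 : ¬ CountablyCovered U (D.cone h' ξ) := fun h3 => h2 (h3.mono (cone_anti hξ))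
    have h4 : Z ξ := ⟨h', h1, h3⟩
    simp only [x, if_pos h4]
    exact huniq ξ h' (g ξ) h1 (hgβ ξ h4) h3 (hgn ξ h4) ξ le_rfl
  have hxβ : ∀ ξ ≤ β, x ξ = h ξ := fun ξ hξ => (F1 (fun _ _ => rfl) hh ξ hξ).symm
  have F2 : ∀ η, Z η → ¬ CountablyCovered U (D.cone x η) := by
    rintro η ⟨h', h1, h2⟩
    rwa [← cone_congr (F1 h1 h2)]
  have hext : ∀ η, Z η → D.Ext η x := fun η hη => by
    refine ext_of_cone_nonempty (Set.nonempty_iff_ne_empty.2 fun he => F2 η hη ?_)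
    rw [he]
    exact CountablyCovered.empty
  have hside : ∀ η, β < η → ∀ n, (n ≠ x η ∨ ¬ Z η) →
      CountablyCovered U (D.cone (Function.update x η n) η) := by
    intro η hη n hn
    by_contra h1
    have h2 : ∀ ξ ≤ β, Function.update x η n ξ = h ξ := fun ξ hξ => by
      rw [Function.update_of_ne (hξ.trans_lt hη).ne, hxβ ξ hξ]
    have h3 := F1 h2 h1 η le_rfl
    rw [Function.update_self] at h3
    exact hn.elim (fun h4 => h4 h3) fun h4 => h4 ⟨_, h2, h1⟩
  -- Everything departing from `x` before `γ` is countably covered. At uncountable cofinality `x`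
  -- restricted to `γ` is itself a point under every label, so its neighbourhoods absorb the late
  -- departures; otherwise a countable union suffices.
  have main : ∀ γ, (∀ η < γ, Z η) → CountablyCovered U (D.cone h β \ D.openCone x γ) := by
    intro γ
    induction γ using WellFoundedLT.induction with
    | ind γ ih =>
    intro hγ
    have hQ : ∀ η < γ, CountablyCovered U (D.cone h β \ D.cone x η) := by
      intro η hη
      rcases le_or_gt η β with h1 | h1
      · refine CountablyCovered.empty.mono fun p hp => hp.2 ?_
        exact cone_anti h1 (by rw [cone_congr hxβ]; exact hp.1)
      · refine (((ih η hη fun η' h' => hγ η' (h'.trans hη)).union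
          (countablyCovered_fiber hU hcov (η, fun ξ => if ξ < η then x ξ else 0))).union
          (CountablyCovered.biUnion (Set.to_countable {n : ℕ | n ≠ x η})
            fun n hn => hside η h1 n (Or.inl hn))).mono ?_
        rintro p ⟨hp1, hp2⟩
        by_cases hp3 : p ∈ D.openCone x η
        · rcases openCone_subset x η hp3 with h4 | h4
          · exact Or.inl (Or.inr h4)
          · right
            obtain ⟨n, hn⟩ := Set.mem_iUnion.1 h4
            refine Set.mem_iUnion₂.2 ⟨n, fun h5 => hp2 ?_, hn⟩
            rwa [h5, Function.update_eq_self] at hn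
        · exact Or.inl (Or.inl ⟨hp1, hp3⟩)
    by_cases hunc : UncCof γ
    · have hz : ∀ y, D.IsPoint (γ, fun ξ => if ξ < γ then x ξ else 0) y := fun y =>
        ⟨hunc.exists_lt, fun ξ hξ => (hunc.exists_between hξ).imp fun _ h => ⟨h.2, h.1⟩,
          fun ξ hξ => if_neg (not_lt.2 hξ), fun β' hβ' => D.ext_congr (hext β' (hγ β' hβ'))
          fun ξ hξ => (if_pos (hξ.trans hβ')).symm, Or.inl hunc⟩
      obtain ⟨η, hη, hnear⟩ := exists_countablyCovered_near hU hcov hz hunc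
      refine ((hQ η hη).union hnear).mono ?_
      rintro p ⟨hp1, hp2⟩
      by_cases hp3 : p ∈ D.cone x η
      · right
        rcases eq_or_leavesAt_or_properlyExtends (hz D.y₀).2.2.1 p.vanishesOutside with
          h4 | ⟨α, h4⟩ | h4
        · exact Or.inl h4
        · refine Or.inr ⟨α, ?_, h4⟩
          by_contra h5
          rw [not_lt] at h5
          rcases h4.2.2.2 with h6 | h6
          · exact (h5.trans_lt hp3.1).ne h6
          · exact h6 ((if_pos (h5.trans_lt hη)).trans (hp3.2 α h5).symm)
        · exact absurd ⟨h4.1.le, fun ξ hξ => (h4.2 ξ hξ).symm.trans (if_pos hξ)⟩ hp2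
      · exact Or.inl ⟨hp1, hp3⟩
    · obtain ⟨s, hs, hsl, hcof⟩ := exists_of_not_uncCof hunc
      refine (CountablyCovered.biUnion hs fun η hη => hQ η (hsl η hη)).mono ?_
      rintro p ⟨hp1, hp2⟩
      by_contra hp3
      have h4 : ∀ η < γ, p ∈ D.cone x η := fun η hη => by
        obtain ⟨ξ, hξ, hle⟩ := hcof η hη
        refine cone_anti hle ?_
        by_contra h5
        exact hp3 (Set.mem_iUnion₂.2 ⟨ξ, hξ, hp1, h5⟩)
      exact hp2 ⟨not_lt.1 fun h5 => (h4 _ h5).1.false, fun ξ hξ => (h4 ξ hξ).2 ξ le_rfl⟩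
  -- Either `x` is a forbidden full branch, or at the first `γ` where bad cones stop the whole
  -- original cone is countably covered.
  by_cases hall : ∀ η, Z η
  · exact hbranch ⟨x, fun η => hext η (hall η)⟩
  · obtain ⟨γ₀, hγ₀⟩ := not_forall.1 hall
    have hne : {η | ¬ Z η}.Nonempty := ⟨γ₀, hγ₀⟩
    have hγ : ¬ Z (wellFounded_lt.min _ hne) := WellFounded.min_mem wellFounded_lt _ hne
    have hlt : ∀ η < wellFounded_lt.min _ hne, Z η := fun η hη => by
      by_contra h1
      exact hη.not_ge (WellFounded.min_le wellFounded_lt h1)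
    set γ := wellFounded_lt.min _ hne
    have hβγ : β < γ := not_le.1 fun h1 => hγ (hZmono h1 hZβ)
    refine hh (((main γ hlt).union ((countablyCovered_fiber hU hcov
      (γ, fun ξ => if ξ < γ then x ξ else 0)).union
      (CountablyCovered.iUnion fun n : ℕ => hside γ hβγ n (Or.inr hγ)))).mono fun p hp => ?_)
    by_cases h1 : p ∈ D.openCone x γ
    · exact Or.inr (openCone_subset x γ h1)
    · exact Or.inl ⟨hp, h1⟩

end TreeData

/-! ### Perfect trees of nodes -/

/-- The list of the first `n` values of `x`, the last one being the head. -/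
def initialList (x : ℕ → Bool) : ℕ → List Bool
  | 0 => []
  | n + 1 => x n :: initialList x n

theorem length_initialList (x : ℕ → Bool) (n : ℕ) : (initialList x n).length = n := by
  induction n with
  | zero => rfl
  | succ n ih => simp [initialList, ih]

theorem initialList_congr {x y : ℕ → Bool} {n : ℕ} (h : ∀ m < n, x m = y m) :
    initialList x n = initialList y n := by
  induction n with
  | zero => rfl
  | succ n ih =>
    rw [initialList, initialList, h n n.lt_succ_self, ih fun m hm => h m (hm.trans n.lt_succ_self)]

/-- A perfect tree of nodes satisfying `Q` all of whose branches have the same length `δ`. -/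
theorem exists_perfect_tree {W : Type} [LinearOrder W] [WellFoundedLT W]
    (hW : ∀ s : Set W, s.Countable → ∃ w, ∀ x ∈ s, x < w) (Q : WSeq W → Prop) (hne : ∃ q, Q q)
    (hsplit : ∀ q, Q q → ∃ η, ∃ g : Bool → W → ℕ, (∀ b, ∀ ξ ≤ q.1, g b ξ = q.2 ξ) ∧
      (∀ b, Q (η, g b)) ∧ ∃ ξ ≤ η, g true ξ ≠ g false ξ) :
    ∃ (δ : W) (S : Set (WSeq W)) (g : (ℕ → Bool) → W → ℕ), S.Countable ∧
      (∀ q ∈ S, Q q ∧ q.1 < δ) ∧ (∃ ξ, ξ < δ) ∧ (∀ ξ < δ, ∃ ξ' < δ, ξ < ξ') ∧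
      Function.Injective g ∧ (∀ x ξ, δ ≤ ξ → g x ξ = 0) ∧
      (∀ x, ∀ η < δ, ∃ q ∈ S, η ≤ q.1 ∧ ∀ ξ ≤ q.1, g x ξ = q.2 ξ) ∧
      ∀ G : Set (W → ℕ), G.Countable →
        {x | ∃ f ∈ G, ∃ η < δ, ∀ ξ, η ≤ ξ → ξ < δ → g x ξ = f ξ}.Countable := by
  classical
  let N : Type := {q : WSeq W // Q q}
  let R : N → N → Prop := fun a b => a.1.1 ≤ b.1.1 ∧ ∀ ξ ≤ a.1.1, b.1.2 ξ = a.1.2 ξ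
  have Rrefl : ∀ a, R a a := fun a => ⟨le_rfl, fun _ _ => rfl⟩
  have Rtrans : ∀ {a b c}, R a b → R b c → R a c := fun h1 h2 =>
    ⟨h1.1.trans h2.1, fun ξ hξ => (h2.2 ξ (hξ.trans h1.1)).trans (h1.2 ξ hξ)⟩
  have hch : ∀ a : N, ∃ ch : Bool → N, (∀ b, R a (ch b) ∧ a.1.1 < (ch b).1.1) ∧
      ∃ ξ, (∀ b, ξ ≤ (ch b).1.1) ∧ (ch true).1.2 ξ ≠ (ch false).1.2 ξ := by
    rintro ⟨q, hq⟩
    obtain ⟨η, g, h1, h2, ξ, hξ, h3⟩ := hsplit q hq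
    have h4 : q.1 < ξ := not_le.1 fun h4 => h3 ((h1 true ξ h4).trans (h1 false ξ h4).symm)
    exact ⟨fun b => ⟨(η, g b), h2 b⟩, fun b => ⟨⟨(h4.trans_le hξ).le, h1 b⟩, h4.trans_le hξ⟩, ξ,
      fun _ => hξ, h3⟩
  choose ch hch hdiff using hch
  obtain ⟨q₀, hq₀⟩ := hne
  let node : List Bool → N := fun l => l.rec ⟨q₀, hq₀⟩ fun b _ a => ch a b
  let S₀ : Set N := Set.range node
  have hS₀ : S₀.Countable := Set.countable_range node
  have hclosed : ∀ a ∈ S₀, ∀ b, ch a b ∈ S₀ := by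
    rintro _ ⟨l, rfl⟩ b
    exact ⟨b :: l, rfl⟩
  have hbd : ∀ a : N, {w | ∀ b ∈ S₀, R a b → b.1.1 < w}.Nonempty := by
    intro a
    obtain ⟨w, hw⟩ := hW ((fun b : N => b.1.1) '' S₀) (hS₀.image _)
    exact ⟨w, fun b hb _ => hw _ ⟨b, hb, rfl⟩⟩
  let dl : N → W := fun a => wellFounded_lt.min _ (hbd a)
  have hdl : ∀ a, ∀ b ∈ S₀, R a b → b.1.1 < dl a := fun a =>
    WellFounded.min_mem wellFounded_lt _ (hbd a)
  have hdl' : ∀ a w, (∀ b ∈ S₀, R a b → b.1.1 < w) → dl a ≤ w := fun a w h =>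
    WellFounded.min_le wellFounded_lt (show w ∈ {w | ∀ b ∈ S₀, R a b → b.1.1 < w} from h)
  -- Minimizing the strict supremum of the lengths above a node makes the lengths above every later
  -- node cofinal in the same `δ`.
  obtain ⟨a₀, ha₀, hmin⟩ : ∃ a₀ ∈ S₀, ∀ a ∈ S₀, dl a₀ ≤ dl a := by
    have h1 : (dl '' S₀).Nonempty := ⟨_, _, ⟨[], rfl⟩, rfl⟩
    obtain ⟨a₀, h2, h3⟩ := WellFounded.min_mem wellFounded_lt _ h1
    exact ⟨a₀, h2, fun a ha => by
      rw [h3]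
      exact WellFounded.min_le wellFounded_lt (show dl a ∈ dl '' S₀ from ⟨a, ha, rfl⟩)⟩
  set δ := dl a₀ with hδ
  have hcof : ∀ a ∈ S₀, R a₀ a → ∀ ε < δ, ∃ b ∈ S₀, R a b ∧ ε ≤ b.1.1 := by
    intro a ha hR ε hε
    by_contra! h
    exact (hmin a ha).not_gt ((hdl' a ε h).trans_lt hε)
  let M : Set N := {a | a ∈ S₀ ∧ R a₀ a}
  have hM : M.Countable := hS₀.mono fun a ha => ha.1
  have ha₀M : a₀ ∈ M := ⟨ha₀, Rrefl a₀⟩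
  obtain ⟨f, hf⟩ := hM.exists_eq_range ⟨a₀, ha₀M⟩
  have hfM : ∀ n, f n ∈ M := fun n => hf ▸ Set.mem_range_self n
  have hMlt : ∀ a ∈ M, a.1.1 < δ := fun a ha => hdl a₀ a ha.1 ha.2
  have hMch : ∀ a ∈ M, ∀ b, ch a b ∈ M := fun a ha b =>
    ⟨hclosed a ha.1 b, Rtrans ha.2 (hch a b).1⟩
  let ε : ℕ → W := fun n => (f n).1.1
  have hε : ∀ n, ε n < δ := fun n => hMlt _ (hfM n)
  have hεcof : ∀ η < δ, ∃ n, η ≤ ε n := by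
    intro η hη
    obtain ⟨b, hb, hR, hle⟩ := hcof a₀ ha₀ (Rrefl a₀) η hη
    have hbM : b ∈ M := ⟨hb, hR⟩
    rw [hf] at hbM
    obtain ⟨n, rfl⟩ := hbM
    exact ⟨n, hle⟩
  have hup : ∀ (a : M) (n : ℕ), ∃ b : M, R a.1 b.1 ∧ ε n ≤ b.1.1.1 := by
    rintro ⟨a, ha⟩ n
    obtain ⟨b, hb, hR, hle⟩ := hcof a ha.1 ha.2 (ε n) (hε n)
    exact ⟨⟨b, hb, Rtrans ha.2 hR⟩, hR, hle⟩
  choose up hupR hupε using hup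
  -- Split first, then climb past `ε n` at stage `n`, so that every branch reaches length exactly
  -- `δ`.
  let u : List Bool → M := fun l =>
    l.rec ⟨a₀, ha₀M⟩ fun b l a => up ⟨ch a.1 b, hMch a.1 a.2 b⟩ l.length
  have hu : ∀ b l, R (ch (u l).1 b) (u (b :: l)).1 := fun b l =>
    hupR ⟨ch (u l).1 b, hMch _ (u l).2 b⟩ l.length
  have huε : ∀ b l, ε l.length ≤ (u (b :: l)).1.1.1 := fun b l =>
    hupε ⟨ch (u l).1 b, hMch _ (u l).2 b⟩ l.length
  let p : (ℕ → Bool) → ℕ → N := fun x n => (u (initialList x n)).1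
  have hpM : ∀ x n, p x n ∈ M := fun x n => (u (initialList x n)).2
  have hpε : ∀ x n, ε n ≤ (p x (n + 1)).1.1 := by
    intro x n
    have := huε (x n) (initialList x n)
    rwa [length_initialList] at this
  have hpR : ∀ x, ∀ m n, m ≤ n → R (p x m) (p x n) := by
    intro x m n hmn
    induction hmn with
    | refl => exact Rrefl _
    | step _ ih => exact Rtrans ih (Rtrans (hch _ _).1 (hu _ _))
  have hex : ∀ x, ∀ ξ < δ, ∃ n, ξ ≤ (p x n).1.1 := by
    intro x ξ hξ
    obtain ⟨n, hn⟩ := hεcof ξ hξ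
    exact ⟨n + 1, hn.trans (hpε x n)⟩
  choose! k hk using hex
  let g : (ℕ → Bool) → W → ℕ := fun x ξ => if ξ < δ then (p x (k x ξ)).1.2 ξ else 0
  have hg : ∀ x n, ∀ ξ ≤ (p x n).1.1, g x ξ = (p x n).1.2 ξ := by
    intro x n ξ hξ
    have hξδ : ξ < δ := hξ.trans_lt (hMlt _ (hpM x n))
    simp only [g, if_pos hξδ]
    rcases le_total n (k x ξ) with h | h
    · exact (hpR x _ _ h).2 ξ hξ
    · exact ((hpR x _ _ h).2 ξ (hk x ξ hξδ)).symm
  have hginj : Function.Injective g := by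
    intro x y hxy
    by_contra hne
    have hex : ∃ n, x n ≠ y n := by
      by_contra! h
      exact hne (funext h)
    have h1 : x (Nat.find hex) ≠ y (Nat.find hex) := Nat.find_spec hex
    have h2 : initialList x (Nat.find hex) = initialList y (Nat.find hex) :=
      initialList_congr fun m hm => not_not.1 (Nat.find_min hex hm)
    set n := Nat.find hex
    obtain ⟨ξ, hξ, hd⟩ := hdiff (p x n)
    have h3 : ∀ z : ℕ → Bool, initialList x n = initialList z n →
        g z ξ = (ch (p x n) (z n)).1.2 ξ := by
      intro z hz
      have h4 : R (ch (p x n) (z n)) (p z (n + 1)) := by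
        have hpz : p x n = p z n := by simp only [p, hz]
        rw [hpz]
        exact hu (z n) (initialList z n)
      rw [hg z (n + 1) ξ ((hξ _).trans h4.1), h4.2 ξ (hξ _)]
    have h5 := (h3 x rfl).symm.trans ((congrFun hxy ξ).trans (h3 y h2))
    cases hx : x n <;> cases hy : y n <;> rw [hx, hy] at h1 h5
    · exact h1 rfl
    · exact hd h5.symm
    · exact hd h5
    · exact h1 rfl
  refine ⟨δ, Subtype.val '' M, g, hM.image _, ?_, ⟨_, hMlt _ ha₀M⟩, ?_, hginj, ?_, ?_, ?_⟩
  · rintro _ ⟨a, ha, rfl⟩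
    exact ⟨a.2, hMlt a ha⟩
  · intro ξ hξ
    obtain ⟨n, hn⟩ := hεcof ξ hξ
    exact ⟨_, hMlt _ (hMch _ (hfM n) true), hn.trans_lt (hch _ _).2⟩
  · intro x ξ hξ
    exact if_neg (not_lt.2 hξ)
  · intro x η hη
    obtain ⟨n, hn⟩ := hεcof η hη
    exact ⟨_, ⟨_, hpM x (n + 1), rfl⟩, hn.trans (hpε x n), hg x (n + 1)⟩
  · intro G hG
    have : Nonempty W := ⟨δ⟩
    choose! F hF e he hagree using
      (fun x (hx : x ∈ {x | ∃ f ∈ G, ∃ η < δ, ∀ ξ, η ≤ ξ → ξ < δ → g x ξ = f ξ}) => hx)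
    choose! m hm using fun x hx => hεcof (e x) (he x hx)
    -- `x` is recovered from the `f ∈ G` giving the tail of `g x` and from enough bits of `x` to fix
    -- `g x` up to that tail.
    refine Set.MapsTo.countable_of_injOn (f := fun x => (F x, initialList x (m x + 1)))
      (t := G ×ˢ Set.univ) (fun x hx => ⟨hF x hx, trivial⟩) ?_ (hG.prod (Set.to_countable _))
    intro x hx y hy hxy
    obtain ⟨h1, h2⟩ := Prod.mk.inj hxy
    have h3 : m x = m y := by
      have := congrArg List.length h2
      simpa [length_initialList] using this
    have h4 : p x (m x + 1) = p y (m x + 1) := by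
      rw [← h3] at h2
      simp only [p, h2]
    refine hginj (funext fun ξ => ?_)
    rcases lt_or_ge ξ δ with hξ | hξ
    · rcases le_or_gt ξ (p x (m x + 1)).1.1 with h5 | h5
      · rw [hg x (m x + 1) ξ h5, hg y (m x + 1) ξ (h4 ▸ h5), h4]
      · have h6 : e x ≤ ξ := (hm x hx).trans ((hpε x (m x)).trans h5.le)
        have h7 : e y ≤ ξ := by
          rw [h4] at h5
          refine (hm y hy).trans ?_
          rw [← h3]
          exact (hpε y (m x)).trans h5.le
        rw [hagree x hx ξ h6 hξ, hagree y hy ξ h7 hξ, h1]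
    · simp only [g, if_neg (not_lt.2 hξ)]

/-! ### The Lindelöf property -/

namespace TreeData

variable {W Y : Type} [LinearOrder W]

/-- Every node of length `δ` is eventually equal to one of countably many sequences. -/
def IsThin (Ext : W → (W → ℕ) → Prop) : Prop :=
  ∀ δ, (∃ ξ, ξ < δ) → ∃ G : Set (W → ℕ), G.Countable ∧
    ∀ h, Ext δ h → ∃ f ∈ G, ∃ η < δ, ∀ ξ, η ≤ ξ → ξ < δ → h ξ = f ξ

/-- The maximal paths of length `δ` approximated by the nodes in `S`. -/
def limitPaths (Ext : W → (W → ℕ) → Prop) (δ : W) (S : Set (WSeq W)) : Set (W → ℕ) :=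
  {h | (∀ ξ, δ ≤ ξ → h ξ = 0) ∧ (∀ β < δ, Ext β h) ∧ ¬ Ext δ h ∧
    ∀ η < δ, ∃ q ∈ S, η ≤ q.1 ∧ ∀ ξ < q.1, q.2 ξ = h ξ}

/-- `reps` contains all nodes up to the identification of sequences with their restrictions. -/
def IsRepresented (Ext : W → (W → ℕ) → Prop) (reps : W → Set (W → ℕ)) : Prop :=
  ∀ β h, Ext β h → ∃ f ∈ reps β, ∀ ξ < β, f ξ = h ξ

/-- A perfect tree of bad cones has `2 ^ ℵ₀` branches, only countably many of them nodes by
thinness. Some maximal path approximated by the tree lies in `D.P`, and its neighbourhood swallows a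
bad cone. -/
theorem lindelofSpace [WellFoundedLT W] {D : TreeData W Y} [TopologicalSpace Y] [LindelofSpace Y]
    (hW : ∀ s : Set W, s.Countable → ∃ w, ∀ x ∈ s, x < w) (hbranch : ¬ ∃ h, ∀ β, D.Ext β h)
    (hthin : IsThin D.Ext) {reps : W → Set (W → ℕ)} (hreps : IsRepresented D.Ext reps)
    (hP : ∀ δ, ∀ S : Set (WSeq W), S.Countable → (∀ q ∈ S, q.1 < δ ∧ q.2 ∈ reps q.1) →
      ¬ (limitPaths D.Ext δ S).Countable → ∃ h ∈ limitPaths D.Ext δ S, (δ, h) ∈ D.P) :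
    LindelofSpace D.Space := by
  refine ⟨isLindelof_of_countable_subcover fun {ι} U hU hcov' => ?_⟩
  have hcov : ∀ p, ∃ i, p ∈ U i := fun p => by simpa using hcov' (Set.mem_univ p)
  show CountablyCovered U Set.univ
  by_contra huniv
  let Q : WSeq W → Prop := fun q => ¬ CountablyCovered U (D.cone q.2 q.1)
  have hne : ∃ q, Q q := by
    by_contra! hQ
    refine huniv ?_
    obtain ⟨b, hb⟩ : ∃ b : W, ∀ w, b ≤ w := by
      obtain ⟨w, -⟩ := hW ∅ Set.countable_empty
      exact ⟨wellFounded_lt.min Set.univ ⟨w, trivial⟩, fun w =>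
        WellFounded.min_le wellFounded_lt (Set.mem_univ w)⟩
    refine (CountablyCovered.iUnion fun n : ℕ => not_not.1 (hQ (b, fun _ => n))).mono fun p _ => ?_
    obtain ⟨ξ, hξ⟩ := p.exists_lt
    refine Set.mem_iUnion.2 ⟨p.seq.2 b, (hb ξ).trans_lt hξ, fun ξ' hξ' => ?_⟩
    rw [le_antisymm hξ' (hb ξ')]
  have hQext : ∀ q, Q q → D.Ext q.1 q.2 := fun q hq => by
    refine ext_of_cone_nonempty (Set.nonempty_iff_ne_empty.2 fun he => hq ?_)
    rw [he]
    exact CountablyCovered.empty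
  obtain ⟨δ, S, g, hS, hSQ, hpos, hlim, hginj, hg0, hgS, hthin'⟩ :=
    exists_perfect_tree hW Q hne fun q hq => exists_split hbranch hU hcov hq
  choose! rep hrep hrepeq using hreps
  -- Values beyond the length are irrelevant but would spoil the count of countable sets of nodes;
  -- hence the passage to representatives.
  let S' : Set (WSeq W) := (fun q : WSeq W => (q.1, rep q.1 q.2)) '' S
  have hS' : S'.Countable := hS.image _
  obtain ⟨G, hG, hGδ⟩ := hthin δ hpos
  have hsub : g '' {x | ¬ D.Ext δ (g x)} ⊆ limitPaths D.Ext δ S' := by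
    rintro _ ⟨x, hx, rfl⟩
    refine ⟨hg0 x, fun β hβ => ?_, hx, fun η hη => ?_⟩
    · obtain ⟨q, hq, hle, heq⟩ := hgS x β hβ
      exact D.ext_congr (D.ext_mono hle (hQext q (hSQ q hq).1))
        fun ξ hξ => (heq ξ (hξ.le.trans hle)).symm
    · obtain ⟨q, hq, hle, heq⟩ := hgS x η hη
      refine ⟨_, ⟨q, hq, rfl⟩, hle, fun ξ hξ => ?_⟩
      exact (hrepeq _ _ (hQext q (hSQ q hq).1) ξ hξ).trans (heq ξ (le_of_lt hξ)).symm
  have hunc : ¬ (limitPaths D.Ext δ S').Countable := by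
    intro hc
    have h1 : {x | ¬ D.Ext δ (g x)}.Countable :=
      Set.countable_of_injective_of_countable_image hginj.injOn (hc.mono hsub)
    have h2 : {x | D.Ext δ (g x)}.Countable := (hthin' G hG).mono fun x hx => hGδ _ hx
    have h3 : (Set.univ : Set (ℕ → Bool)).Countable :=
      (h1.union h2).mono fun x _ => (em (D.Ext δ (g x))).symm
    have h4 := Cardinal.le_aleph0_iff_set_countable.2 h3
    rw [Cardinal.mk_univ] at h4
    have h5 : #(ℕ → Bool) = 2 ^ ℵ₀ := by simp
    rw [h5] at h4
    exact (Cardinal.cantor ℵ₀).not_ge h4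
  obtain ⟨h, hh, hhP⟩ := hP δ S' hS' (by
    rintro _ ⟨q, hq, rfl⟩
    exact ⟨(hSQ q hq).2, hrep _ _ (hQext q (hSQ q hq).1)⟩) hunc
  obtain ⟨hh0, hhp, hhext, hhS⟩ := hh
  have hδ : ¬ UncCof δ := by
    intro h1
    obtain ⟨η, hη, hlt⟩ := h1 (Prod.fst '' S') (hS'.image _) (by
      rintro _ ⟨_, ⟨q, hq, rfl⟩, rfl⟩
      exact (hSQ q hq).2)
    obtain ⟨q, hq, hle, -⟩ := hhS η hη
    exact (hlt _ ⟨q, hq, rfl⟩).not_ge hle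
  let p : D.Space := ⟨((δ, h), D.y₀), hpos, hlim, hh0, hhp, Or.inr ⟨hδ, hhext, hhP, rfl⟩⟩
  obtain ⟨i, hi⟩ := hcov p
  obtain ⟨O, hO, hpO, η, hη, hsub'⟩ := isOpen_iff.1 (hU i) p hi
  obtain ⟨η', hη', hlt⟩ := hlim η hη
  obtain ⟨_, ⟨q, hq, rfl⟩, hle, heq⟩ := hhS η' hη'
  -- The cone at `q` agrees with `p` past `η`; its points cannot properly extend `p`, and all who
  -- leave `p` are put at the base point, which lies in `O`.
  refine (hSQ q hq).1 (CountablyCovered.of_subset (i := i) fun r hr => hsub' ?_)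
  have hqη : η < q.1 := hlt.trans_le hle
  have hrh : ∀ ξ ≤ η, r.seq.2 ξ = h ξ := fun ξ hξ => by
    rw [hr.2 ξ (hξ.trans hqη.le), ← heq ξ (hξ.trans_lt hqη)]
    exact (hrepeq _ _ (hQext q (hSQ q hq).1) ξ (hξ.trans_lt hqη)).symm
  rcases eq_or_leavesAt_or_properlyExtends p.vanishesOutside r.vanishesOutside with
    h4 | ⟨α, h4⟩ | h4
  · refine Or.inl ⟨h4, ?_⟩
    rw [r.lab_eq (by rw [h4]; exact hδ)]
    exact hpO
  · refine Or.inr ⟨α, ?_, h4, ?_⟩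
    · by_contra h5
      rw [not_lt] at h5
      rcases h4.2.2.2 with h6 | h6
      · exact (h5.trans_lt (hqη.trans hr.1)).ne h6
      · exact h6 (hrh α h5).symm
    · rw [D.φ_base p.seq.1 hδ]
      exact hpO
  · exact absurd h4 (p.not_properlyExtends r hδ)

end TreeData

/-! ### From thin trees to products of large extent -/

theorem isClosed_and_discreteTopology_of_subsingleton {X : Type*} [TopologicalSpace X] [T1Space X]
    {C : Set X} (h : ∀ x, ∃ U, IsOpen U ∧ x ∈ U ∧ (U ∩ C).Subsingleton) :
    IsClosed C ∧ DiscreteTopology C := by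
  constructor
  · refine ⟨isOpen_iff_forall_mem_open.2 fun x hx => ?_⟩
    obtain ⟨U, hU, hxU, hs⟩ := h x
    exact ⟨U \ (U ∩ C), fun y hy hyC => hy.2 ⟨hy.1, hyC⟩, hU.sdiff hs.finite.isClosed, hxU,
      fun h' => hx h'.2⟩
  · refine discreteTopology_iff_isOpen_singleton.2 fun x => ?_
    obtain ⟨U, hU, hxU, hs⟩ := h x
    refine isOpen_induced_iff.2 ⟨U, hU, Set.Subset.antisymm (fun y hy => ?_) ?_⟩
    · exact Subtype.ext (hs ⟨hy, y.2⟩ ⟨hxU, x.2⟩)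
    · rintro _ rfl
      exact hxU

/-! ### Bernstein splitting and the two spaces -/

namespace TreeData

/-- By induction, a node of length `β` is a shorter representative followed by a tail of one of
countably many sequences, which gives at most `ℵ₁` combinations. -/
theorem exists_reps {Ext : OmegaTwo → (OmegaTwo → ℕ) → Prop}
    (hmono : ∀ {β β' h}, β' ≤ β → Ext β h → Ext β' h) (hthin : IsThin Ext) (β : OmegaTwo) :
    ∃ R : Set (OmegaTwo → ℕ), #R ≤ ℵ₁ ∧ ∀ h, Ext β h → ∃ f ∈ R, ∀ ξ < β, f ξ = h ξ := by
  classical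
  induction β using WellFoundedLT.induction with
  | ind β ih =>
  by_cases hβ : ∃ ξ, ξ < β
  · choose! R hR hRep using ih
    obtain ⟨G, hG, hGβ⟩ := hthin β hβ
    let F : (Σ η : Set.Iio β, R η.1 × G) → OmegaTwo → ℕ := fun t ξ =>
      if ξ < t.1.1 then t.2.1.1 ξ else t.2.2.1 ξ
    refine ⟨Set.range F, Cardinal.mk_range_le.trans ?_, fun h hh => ?_⟩
    · rw [Cardinal.mk_sigma]
      refine (Cardinal.sum_le_sum _ (fun _ => ℵ₁ * ℵ₁) fun η => ?_).trans ?_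
      · rw [Cardinal.mk_prod, Cardinal.lift_id, Cardinal.lift_id]
        exact mul_le_mul' (hR _ η.2)
          ((Cardinal.le_aleph0_iff_set_countable.2 hG).trans (Cardinal.aleph0_le_aleph 1))
      · rw [Cardinal.sum_const', Cardinal.mul_eq_self (Cardinal.aleph0_le_aleph 1)]
        exact (mul_le_mul' (mk_Iio_omegaTwo_le β) le_rfl).trans
          (Cardinal.mul_eq_self (Cardinal.aleph0_le_aleph 1)).le
    · obtain ⟨f, hf, η, hη, hfη⟩ := hGβ h hh
      obtain ⟨f', hf', hfη'⟩ := hRep η hη h (hmono hη.le hh)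
      refine ⟨_, ⟨⟨⟨η, hη⟩, ⟨f', hf'⟩, ⟨f, hf⟩⟩, rfl⟩, fun ξ hξ => ?_⟩
      simp only [F]
      split_ifs with h1
      · exact hfη' ξ h1
      · exact (hfη ξ (not_lt.1 h1) hξ).symm
  · refine ⟨{fun _ => 0}, ?_, fun h _ => ⟨_, rfl, fun ξ hξ => absurd ⟨ξ, hξ⟩ hβ⟩⟩
    rw [Cardinal.mk_singleton]
    exact Cardinal.one_le_aleph0.trans (Cardinal.aleph0_le_aleph 1)

/-- Under the Continuum Hypothesis the maximal paths of countable cofinality can be split into two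
parts each of which meets all uncountable sets of limit paths. -/
theorem exists_bernstein (hCH : (2 : Cardinal.{0}) ^ ℵ₀ = ℵ₁)
    {Ext : OmegaTwo → (OmegaTwo → ℕ) → Prop} {reps : OmegaTwo → Set (OmegaTwo → ℕ)}
    (hreps : ∀ β, #(reps β) ≤ ℵ₁) :
    ∃ P : Set (WSeq OmegaTwo), ∀ δ, ∀ S : Set (WSeq OmegaTwo), S.Countable →
      (∀ q ∈ S, q.1 < δ ∧ q.2 ∈ reps q.1) → ¬ (limitPaths Ext δ S).Countable →
      (∃ h ∈ limitPaths Ext δ S, (δ, h) ∈ P) ∧ ∃ h ∈ limitPaths Ext δ S, (δ, h) ∈ Pᶜ := by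
  have key : ∀ δ : OmegaTwo, ∃ P : Set (OmegaTwo → ℕ), ∀ S : Set (WSeq OmegaTwo), S.Countable →
      (∀ q ∈ S, q.1 < δ ∧ q.2 ∈ reps q.1) → ¬ (limitPaths Ext δ S).Countable →
      (limitPaths Ext δ S ∩ P).Nonempty ∧ (limitPaths Ext δ S \ P).Nonempty := by
    intro δ
    let A : Set (WSeq OmegaTwo) := {q | q.1 < δ ∧ q.2 ∈ reps q.1}
    have hA : #A ≤ ℵ₁ := by
      let F : (Σ η : Set.Iio δ, reps η.1) → WSeq OmegaTwo := fun t => (t.1.1, t.2.1)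
      have h1 : A ⊆ Set.range F := fun q hq => ⟨⟨⟨q.1, hq.1⟩, ⟨q.2, hq.2⟩⟩, rfl⟩
      refine (Cardinal.mk_le_mk_of_subset h1).trans (Cardinal.mk_range_le.trans ?_)
      rw [Cardinal.mk_sigma]
      refine (Cardinal.sum_le_sum _ (fun _ => ℵ₁) fun η => hreps _).trans ?_
      rw [Cardinal.sum_const']
      exact (mul_le_mul' (mk_Iio_omegaTwo_le δ) le_rfl).trans
          (Cardinal.mul_eq_self (Cardinal.aleph0_le_aleph 1)).le
    let ι : Type := {S : Set (WSeq OmegaTwo) // (S ⊆ A ∧ #S ≤ ℵ₀) ∧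
      ¬ (limitPaths Ext δ S).Countable}
    have hι : #ι ≤ ℵ₁ := by
      have h1 : #ι ≤ #{S : Set (WSeq OmegaTwo) // S ⊆ A ∧ #S ≤ ℵ₀} :=
        Cardinal.mk_le_of_injective (f := fun S : ι => ⟨S.1, S.2.1⟩) fun S T h =>
          Subtype.ext (Subtype.mk.inj h)
      refine h1.trans ((Cardinal.mk_bounded_subset_le A ℵ₀).trans ?_)
      -- CH is needed here: at most `ℵ₁` countable sets of representatives have to be handled.
      calc max #A ℵ₀ ^ ℵ₀ ≤ ((2 : Cardinal.{0}) ^ ℵ₀) ^ ℵ₀ := by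
            refine Cardinal.power_le_power_right (max_le (hA.trans hCH.ge) ?_)
            exact (Cardinal.cantor ℵ₀).le
        _ = ℵ₁ := by rw [← Cardinal.power_mul, Cardinal.aleph0_mul_aleph0, hCH]
    obtain ⟨P, hP⟩ := exists_splitting_set hι (fun S => limitPaths Ext δ S.1) fun S => S.2.2
    exact ⟨P, fun S h1 h2 h3 => hP ⟨S, ⟨h2, Cardinal.le_aleph0_iff_set_countable.2 h1⟩, h3⟩⟩
  choose P hP using key
  refine ⟨{q | q.2 ∈ P q.1}, fun δ S h1 h2 h3 => ?_⟩
  obtain ⟨⟨h, hh, hhP⟩, ⟨h', hh', hhP'⟩⟩ := hP δ S h1 h2 h3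
  exact ⟨⟨h, hh, hhP⟩, ⟨h', hh', hhP'⟩⟩

open Classical in
/-- The tree data whose fibres are Sorgenfrey lines. -/
noncomputable def sorgenfrey (Ext : OmegaTwo → (OmegaTwo → ℕ) → Prop)
    (hcongr : ∀ {β h h'}, Ext β h → (∀ ξ < β, h ξ = h' ξ) → Ext β h')
    (hmono : ∀ {β β' h}, β' ≤ β → Ext β h → Ext β' h) (P : Set (WSeq OmegaTwo))
    (r : OmegaOne → ℝ) (hr : Function.Injective r) (ψ : OmegaTwo → OmegaTwo → OmegaOne)
    (hψ : ∀ l, UncCof l → (∀ ξ, ∃ b < l, ∀ α < l, ψ l α = ξ → α ≤ b) ∧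
      ∀ μ < l, UncCof μ → ∃ η < μ, ∀ α, η < α → α ≤ μ → ψ l α = ψ l μ) :
    TreeData OmegaTwo SorgenfreyLine where
  Ext := Ext
  ext_congr := hcongr
  ext_mono := hmono
  P := P
  y₀ := .ofReal 0
  φ l α := if UncCof l then .ofReal (r (ψ l α)) else .ofReal 0
  φ_bdd := by
    intro l hl y
    simp only [if_pos hl]
    by_cases h : ∃ ξ, SorgenfreyLine.ofReal (r ξ) = y
    · obtain ⟨ξ, rfl⟩ := h
      obtain ⟨b, hb, h'⟩ := (hψ l hl).1 ξ
      exact ⟨b, hb, fun α hα h1 => h' α hα (hr h1)⟩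
    · obtain ⟨b, hb⟩ := hl.exists_lt
      exact ⟨b, hb, fun α _ h1 => absurd ⟨_, h1⟩ h⟩
  φ_const := by
    intro l μ hμ hunc
    by_cases hl : UncCof l
    · obtain ⟨η, hη, h⟩ := (hψ l hl).2 μ hμ hunc
      exact ⟨η, hη, fun α h1 h2 => by rw [h α h1 h2]⟩
    · obtain ⟨η, hη⟩ := hunc.exists_lt
      exact ⟨η, hη, fun α _ _ => by simp only [if_neg hl]⟩
  φ_base := fun l hl α => if_neg hl

theorem exists_spaces (hCH : (2 : Cardinal.{0}) ^ ℵ₀ = ℵ₁)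
    {Ext : OmegaTwo → (OmegaTwo → ℕ) → Prop}
    (hcongr : ∀ {β h h'}, Ext β h → (∀ ξ < β, h ξ = h' ξ) → Ext β h')
    (hmono : ∀ {β β' h}, β' ≤ β → Ext β h → Ext β' h) (hbranch : ¬ ∃ h, ∀ β, Ext β h)
    (hthin : IsThin Ext) {J : Type} (hJ : ℵ₁ < #J) (z : J → WSeq OmegaTwo)
    (hz : Function.Injective z) (hunc : ∀ j, UncCof (z j).1) (hvan : ∀ j, VanishesOutside (z j))
    (hpath : ∀ j, ∀ β < (z j).1, Ext β (z j).2) :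
    ∃ (X₀ X₁ : Type) (_ : TopologicalSpace X₀) (_ : TopologicalSpace X₁),
      (RegularSpace X₀ ∧ T1Space X₀ ∧ LindelofSpace X₀ ∧ ∀ x : X₀, IsGδ ({x} : Set X₀)) ∧
      (RegularSpace X₁ ∧ T1Space X₁ ∧ LindelofSpace X₁ ∧ ∀ x : X₁, IsGδ ({x} : Set X₁)) ∧
      (2 : Cardinal.{0}) ^ ℵ₀ < extent (X₀ × X₁) := by
  classical
  choose reps hreps hreps' using exists_reps (Ext := Ext) hmono hthin
  obtain ⟨P, hP⟩ := exists_bernstein (Ext := Ext) hCH hreps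
  obtain ⟨⟨r, hr⟩⟩ : Nonempty (OmegaOne ↪ ℝ) := by
    rw [← Cardinal.le_def]
    simp
  have hr' : Function.Injective fun ξ => -r ξ := fun a b h => hr (neg_injective h)
  have hψ : ∀ l : OmegaTwo, ∃ ψ : OmegaTwo → OmegaOne, UncCof l →
      (∀ ξ, ∃ b < l, ∀ α < l, ψ α = ξ → α ≤ b) ∧
      ∀ μ < l, UncCof μ → ∃ η < μ, ∀ α, η < α → α ≤ μ → ψ α = ψ μ := by
    intro l
    by_cases hl : ∃ ξ, ξ < l
    · obtain ⟨ψ, h⟩ := exists_rank_map l hl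
      exact ⟨ψ, fun _ => h⟩
    · obtain ⟨ξ⟩ : Nonempty OmegaOne := by
        rw [← Cardinal.mk_ne_zero_iff, Cardinal.mk_ord_toType]
        exact (Cardinal.aleph_pos 1).ne'
      exact ⟨fun _ => ξ, fun h => absurd h.exists_lt hl⟩
  choose ψ hψ using hψ
  let D₀ := sorgenfrey Ext hcongr hmono P r hr ψ hψ
  -- The two spaces differ only in the sign of the labels and in which countable-cofinality paths
  -- are admitted.
  let D₁ := sorgenfrey Ext hcongr hmono Pᶜ (fun ξ => -r ξ) hr' ψ hψ
  have : T1Space SorgenfreyLine := ⟨fun x => ⟨SorgenfreyLine.isClosed_singleton' x⟩⟩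
  have hclopen : ∀ (U : Set SorgenfreyLine) (y : SorgenfreyLine), IsOpen U → y ∈ U →
      ∃ V, IsClopen V ∧ y ∈ V ∧ V ⊆ U := fun U y hU hy =>
    SorgenfreyLine.exists_isClopen_subset hU hy
  have hT₀ : T1Space D₀.Space := t1Space
  have hT₁ : T1Space D₁.Space := t1Space
  refine ⟨D₀.Space, D₁.Space, inferInstance, inferInstance,
    ⟨regularSpace hclopen, hT₀, ?_, isGδ_singleton SorgenfreyLine.isGδ_singleton⟩,
    ⟨regularSpace hclopen, hT₁, ?_, isGδ_singleton SorgenfreyLine.isGδ_singleton⟩, ?_⟩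
  · exact lindelofSpace (fun s hs => exists_forall_lt_of_countable hs) hbranch hthin hreps'
      fun δ S h1 h2 h3 => (hP δ S h1 h2 h3).1
  · exact lindelofSpace (fun s hs => exists_forall_lt_of_countable hs) hbranch hthin hreps'
      fun δ S h1 h2 h3 => (hP δ S h1 h2 h3).2
  have hlim : ∀ j, ∀ ξ < (z j).1, ∃ ξ' < (z j).1, ξ < ξ' := fun j ξ hξ =>
    ((hunc j).exists_between hξ).imp fun _ h => ⟨h.2, h.1⟩
  let p₀ : J → D₀.Space := fun j =>
    ⟨(z j, .ofReal 0), (hunc j).exists_lt, hlim j, hvan j, hpath j, Or.inl (hunc j)⟩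
  let p₁ : J → D₁.Space := fun j =>
    ⟨(z j, .ofReal 0), (hunc j).exists_lt, hlim j, hvan j, hpath j, Or.inl (hunc j)⟩
  let C : Set (D₀.Space × D₁.Space) := Set.range fun j => (p₀ j, p₁ j)
  have hC : IsClosed C ∧ DiscreteTopology C := by
    refine isClosed_and_discreteTopology_of_subsingleton fun ⟨a, b⟩ => ?_
    suffices h : ∃ (U : Set D₀.Space) (V : Set D₁.Space), IsOpen U ∧ IsOpen V ∧ a ∈ U ∧ b ∈ V ∧
        ∀ j, p₀ j ∈ U → p₁ j ∈ V → z j = a.seq by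
      obtain ⟨U, V, hU, hV, ha, hb, h⟩ := h
      refine ⟨U ×ˢ V, hU.prod hV, ⟨ha, hb⟩, ?_⟩
      rintro _ ⟨⟨h1, h2⟩, ⟨j, rfl⟩⟩ _ ⟨⟨h3, h4⟩, ⟨k, rfl⟩⟩
      rw [hz ((h j h1 h2).trans (h k h3 h4).symm)]
    rcases eq_or_leavesAt_or_properlyExtends a.vanishesOutside b.vanishesOutside with
      hab | ⟨α, hab⟩ | hab
    · have hua : UncCof a.seq.1 := by
        by_contra hn
        have h1 : a.seq ∈ P := a.mem_P hn
        have h2 : b.seq ∈ Pᶜ := b.mem_P (by rwa [hab])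
        exact h2 (hab ▸ h1)
      obtain ⟨O, O', hO, hO', ha, hb, hanti⟩ :=
        SorgenfreyLine.exists_antidiagonal_nhds a.lab b.lab
      -- At most one antidiagonal point `(r ξ, -r ξ)` lies in `O × O'`, and the places with rank `ξ`
      -- are bounded, so no `z j` can leave beyond `η` in both factors.
      obtain ⟨η, hη, hηb⟩ : ∃ η < a.seq.1, ∀ α < a.seq.1,
          SorgenfreyLine.ofReal (r (ψ a.seq.1 α)) ∈ O →
          SorgenfreyLine.ofReal (-r (ψ a.seq.1 α)) ∈ O' → α ≤ η := by
        by_cases hex : ∃ ξ, SorgenfreyLine.ofReal (r ξ) ∈ O ∧ SorgenfreyLine.ofReal (-r ξ) ∈ O'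
        · obtain ⟨ξ, h1, h2⟩ := hex
          obtain ⟨η, hη, h⟩ := (hψ _ hua).1 ξ
          exact ⟨η, hη, fun α hα h3 h4 => h α hα (hr (hanti _ _ h3 h4 h1 h2))⟩
        · obtain ⟨η, hη⟩ := hua.exists_lt
          exact ⟨η, hη, fun α _ h3 h4 => absurd ⟨_, h3, h4⟩ hex⟩
      refine ⟨D₀.nbd a.seq O η, D₁.nbd b.seq O' η, isOpen_nbd_seq a hO hη,
        isOpen_nbd_seq b hO' (by rwa [hab]), mem_nbd_self ha, mem_nbd_self hb, ?_⟩
      rintro j (⟨h1, -⟩ | ⟨α, h1, h2, h3⟩) h4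
      · exact h1
      · rw [hab] at h4
        rcases h4 with ⟨h4, -⟩ | ⟨β, h4, h5, h6⟩
        · exact h4
        · exfalso
          have hβ : α = β := h2.unique h5
          subst hβ
          have h3' : (if UncCof a.seq.1 then SorgenfreyLine.ofReal (r (ψ a.seq.1 α))
            else .ofReal 0) ∈ O := h3
          have h6' : (if UncCof a.seq.1 then SorgenfreyLine.ofReal (-r (ψ a.seq.1 α))
            else .ofReal 0) ∈ O' := h6
          rw [if_pos hua] at h3' h6'
          exact h1.not_ge (hηb α h2.1 h3' h6')
    -- Points near `b` leave `a` no later than `α`, while points near `a` are over `a.seq` itself or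
    -- leave it after `α`.
    · obtain ⟨η, hη, h⟩ := exists_leavesAt_of_mem_nbd (D := D₁) (fun _ h => a.ext_of_lt h) hab α
      refine ⟨D₀.nbd a.seq Set.univ α, D₁.nbd b.seq Set.univ η, isOpen_nbd_seq a isOpen_univ hab.1,
        isOpen_nbd_seq b isOpen_univ hη, mem_nbd_self trivial, mem_nbd_self trivial, ?_⟩
      rintro j (⟨h1, -⟩ | ⟨β, h1, h2, -⟩) h4
      · exact h1
      · obtain ⟨α', h5, -, h6, -⟩ := h _ h4
        rw [h2.unique h5] at h1
        exact absurd h1 (not_lt.2 h6)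
    · have hba := hab.leavesAt
      obtain ⟨η, hη, h⟩ := exists_leavesAt_of_mem_nbd (D := D₀) (fun _ h => b.ext_of_lt h) hba
        a.seq.1
      refine ⟨D₀.nbd a.seq Set.univ η, D₁.nbd b.seq Set.univ a.seq.1,
        isOpen_nbd_seq a isOpen_univ hη, isOpen_nbd_seq b isOpen_univ hab.1,
        mem_nbd_self trivial, mem_nbd_self trivial, ?_⟩
      rintro j h4 (⟨h1, -⟩ | ⟨β, h1, h2, -⟩)
      · obtain ⟨α', h5, -⟩ := h _ h4
        have h1' : (p₀ j).seq = b.seq := h1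
        rw [h1'] at h5
        exact absurd h5 not_leavesAt_self
      · obtain ⟨α', h5, -, h6, -⟩ := h _ h4
        rw [h2.unique h5] at h1
        exact absurd h1 (not_lt.2 h6)
  have hcard : #J = #C := by
    refine (Cardinal.mk_range_eq _ fun j k h => hz ?_).symm
    exact congrArg Space.seq (Prod.mk.inj h).1
  rw [hCH]
  calc ℵ₁ < #J := hJ
    _ = #C := hcard
    _ ≤ extent (D₀.Space × D₁.Space) :=
      le_ciSup (f := fun C : {C : Set (D₀.Space × D₁.Space) // IsClosed C ∧ DiscreteTopology C} =>
        #C.1) Cardinal.bddAbove_of_small ⟨C, hC⟩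

end TreeData

/-! ### The ordinals below `ω₂` -/

/-- The elements of `OmegaTwo` are the ordinals below `ω₂`. -/
noncomputable def omegaTwoIso : OmegaTwo ≃o Set.Iio (ω_ 2 : Ordinal.{0}) :=
  Ordinal.ToType.mk.symm.trans (OrderIso.setCongr _ _ (by rw [Cardinal.ord_aleph]))

/-- The ordinal corresponding to an element of `OmegaTwo`. -/
noncomputable def ordOf (w : OmegaTwo) : Ordinal.{0} := (omegaTwoIso w).1

theorem ordOf_lt_omega (w : OmegaTwo) : ordOf w < ω_ 2 := (omegaTwoIso w).2

theorem ordOf_lt_ordOf {v w : OmegaTwo} : ordOf v < ordOf w ↔ v < w := omegaTwoIso.lt_iff_lt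

theorem ordOf_le_ordOf {v w : OmegaTwo} : ordOf v ≤ ordOf w ↔ v ≤ w := omegaTwoIso.le_iff_le

theorem ordOf_injective : Function.Injective ordOf :=
  Subtype.val_injective.comp omegaTwoIso.injective

theorem exists_ordOf_eq {o : Ordinal.{0}} (ho : o < ω_ 2) : ∃ w, ordOf w = o :=
  ⟨omegaTwoIso.symm ⟨o, ho⟩, by simp [ordOf]⟩

/-! ### Kurepa trees -/

section Kurepa

variable {T : Type} [PartialOrder T] [IsSetTree T]

theorem treeHeight_lt_of_lt {s t : T} (h : s < t) : treeHeight s < treeHeight t := by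
  have := IsSetTree.isWellOrder_Iio s
  have := IsSetTree.isWellOrder_Iio t
  refine Ordinal.type_lt_iff.2 ⟨⟨⟨⟨fun x => ⟨x.1, lt_trans x.2 h⟩, fun x y hxy => ?_⟩, Iff.rfl⟩,
    ⟨s, h⟩, fun b => ?_⟩⟩
  · exact Subtype.ext (congrArg (fun z : Set.Iio t => z.1) hxy)
  · constructor
    · rintro ⟨x, rfl⟩
      exact x.2
    · intro hb
      exact ⟨⟨b.1, hb⟩, rfl⟩

theorem eq_of_treeHeight_eq {s t : T} (hst : s ≤ t ∨ t ≤ s) (h : treeHeight s = treeHeight t) :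
    s = t := by
  rcases hst with h1 | h1
  · exact h1.eq_or_lt.resolve_right fun h2 => (treeHeight_lt_of_lt h2).ne h
  · exact (h1.eq_or_lt.resolve_right fun h2 => (treeHeight_lt_of_lt h2).ne h.symm).symm

theorem eq_of_lt_of_treeHeight_eq {s s' t : T} (hs : s < t) (hs' : s' < t)
    (h : treeHeight s = treeHeight s') : s = s' := by
  have := IsSetTree.isWellOrder_Iio t
  rcases trichotomous_of (· < · : Set.Iio t → Set.Iio t → Prop) ⟨s, hs⟩ ⟨s', hs'⟩ with h1 | h1 | h1
  · exact eq_of_treeHeight_eq (Or.inl (le_of_lt h1)) h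
  · exact congrArg Subtype.val h1
  · exact eq_of_treeHeight_eq (Or.inr (le_of_lt h1)) h

theorem exists_level_code (hT : IsOmegaOneTree T) : ∃ c : T → ℕ, ∀ s t,
    treeHeight s = treeHeight t → c s = c t → s = t := by
  choose f hf using fun α => Set.countable_iff_exists_injOn.1 (hT.level_countable α)
  exact ⟨fun t => f (treeHeight t) t, fun s t h h' => hf (treeHeight t) h rfl (by
    simpa only [h] using h')⟩

end Kurepa

/-- Record a cofinal branch by the codes of its nodes. The code at level `δ` alone determines the
branch below, so each level of the tree of codes is countable and thinness is immediate. -/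
theorem exists_spaces_of_kurepa (hCH : (2 : Cardinal.{0}) ^ ℵ₀ = ℵ₁) {T : Type} [PartialOrder T]
    [IsSetTree T] (hT : IsKurepaTree T) :
    ∃ (X₀ X₁ : Type) (_ : TopologicalSpace X₀) (_ : TopologicalSpace X₁),
      (RegularSpace X₀ ∧ T1Space X₀ ∧ LindelofSpace X₀ ∧ ∀ x : X₀, IsGδ ({x} : Set X₀)) ∧
      (RegularSpace X₁ ∧ T1Space X₁ ∧ LindelofSpace X₁ ∧ ∀ x : X₁, IsGδ ({x} : Set X₁)) ∧
      (2 : Cardinal.{0}) ^ ℵ₀ < extent (X₀ × X₁) := by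
  classical
  let J : Type := {B : Set T // IsCofinalBranch B}
  have hJ : ℵ₁ < #J := hT.card_branches
  have : Nonempty J := Cardinal.mk_ne_zero_iff.1 ((Cardinal.aleph_pos 1).trans hJ).ne'
  obtain ⟨w₁, hw₁⟩ := exists_ordOf_eq (o := ω₁) (Ordinal.omega_lt_omega.2 one_lt_two)
  obtain ⟨c, hc⟩ := exists_level_code hT.isOmegaOneTree
  have hlt : ∀ {ξ}, ξ < w₁ → ordOf ξ < ω₁ := fun h => hw₁ ▸ ordOf_lt_ordOf.2 h
  have hnode : ∀ (B : J) (ξ : OmegaTwo), ∃ t : T, ξ < w₁ → t ∈ B.1 ∧ treeHeight t = ordOf ξ := by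
    intro B ξ
    by_cases hξ : ξ < w₁
    · obtain ⟨t, h1, h2⟩ := B.2.meets _ (hlt hξ)
      exact ⟨t, fun _ => ⟨h1, h2⟩⟩
    · obtain ⟨t, -, -⟩ := B.2.meets 0 (Ordinal.omega_pos 1)
      exact ⟨t, fun h => absurd h hξ⟩
  choose nd hnd using hnode
  let g : J → OmegaTwo → ℕ := fun B ξ => if ξ < w₁ then c (nd B ξ) else 0
  have hchain : ∀ (B : J) {s t : T}, s ∈ B.1 → t ∈ B.1 → s ≤ t ∨ t ≤ s := fun B s t hs ht =>
    B.2.isMaxChain.isChain.total hs ht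
  have hbelow : ∀ (B : J) {ξ δ}, ξ < δ → δ < w₁ → nd B ξ < nd B δ := by
    intro B ξ δ hξ hδ
    have h1 := hnd B ξ (hξ.trans hδ)
    have h2 := hnd B δ hδ
    have h3 : treeHeight (nd B ξ) < treeHeight (nd B δ) := by
      rw [h1.2, h2.2]
      exact ordOf_lt_ordOf.2 hξ
    rcases hchain B h1.1 h2.1 with h | h
    · exact h.lt_of_ne fun h' => h3.ne (by rw [h'])
    · rcases h.eq_or_lt with h' | h'
      · exact absurd h3 (by rw [h']; exact lt_irrefl _)
      · exact absurd (treeHeight_lt_of_lt h') h3.not_gt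
  have hnode_eq : ∀ (B B' : J) {ξ}, ξ < w₁ → c (nd B ξ) = c (nd B' ξ) → nd B ξ = nd B' ξ :=
    fun B B' ξ hξ h => hc _ _ (by rw [(hnd B ξ hξ).2, (hnd B' ξ hξ).2]) h
  have hcoh : ∀ (B B' : J) {δ}, δ < w₁ → c (nd B δ) = c (nd B' δ) → ∀ ξ < δ, g B ξ = g B' ξ := by
    intro B B' δ hδ h ξ hξ
    have h1 := hnode_eq B B' hδ h
    have h2 : nd B ξ = nd B' ξ := by
      refine eq_of_lt_of_treeHeight_eq (hbelow B hξ hδ) (h1 ▸ hbelow B' hξ hδ) ?_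
      rw [(hnd B ξ (hξ.trans hδ)).2, (hnd B' ξ (hξ.trans hδ)).2]
    simp only [g, h2]
  -- Cutting off at `w₁` rules out branches of length `ω₂` and turns the cofinal branches into paths
  -- of length `ω₁`.
  let Ext : OmegaTwo → (OmegaTwo → ℕ) → Prop := fun β h => β < w₁ ∧ ∃ B : J, ∀ ξ < β, g B ξ = h ξ
  refine TreeData.exists_spaces hCH (Ext := Ext) ?_ ?_ ?_ ?_ hJ (fun B => (w₁, g B)) ?_ ?_ ?_ ?_
  · rintro β h h' ⟨h1, B, h2⟩ h3
    exact ⟨h1, B, fun ξ hξ => (h2 ξ hξ).trans (h3 ξ hξ)⟩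
  · rintro β β' h hle ⟨h1, B, h2⟩
    exact ⟨hle.trans_lt h1, B, fun ξ hξ => h2 ξ (hξ.trans_le hle)⟩
  · rintro ⟨h, hh⟩
    exact (hh w₁).1.false
  · rintro δ ⟨η, hη⟩
    by_cases hδ : δ < w₁
    · let s : ℕ → J := Function.invFun fun B => c (nd B δ)
      refine ⟨Set.range fun n => g (s n), Set.countable_range _, ?_⟩
      rintro h ⟨-, B, hB⟩
      refine ⟨_, ⟨c (nd B δ), rfl⟩, η, hη, fun ξ _ hξ => ?_⟩
      rw [← hB ξ hξ]
      exact hcoh _ _ hδ (Function.invFun_eq (f := fun B => c (nd B δ)) ⟨B, rfl⟩).symm ξ hξ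
    · exact ⟨∅, Set.countable_empty, fun h hh => absurd hh.1 hδ⟩
  · intro B B' h
    have h1 : g B = g B' := (Prod.mk.inj h).2
    have h2 : ∀ ξ < w₁, nd B ξ = nd B' ξ := fun ξ hξ => hnode_eq B B' hξ (by
      simpa [g, hξ] using congrFun h1 ξ)
    have h3 : ∀ (B : J) t, t ∈ B.1 ↔ ∃ ξ < w₁, t = nd B ξ := by
      intro B t
      constructor
      · intro ht
        have h4 : treeHeight t < ω₁ := (hT.isOmegaOneTree.level_nonempty_iff _).1 ⟨t, rfl⟩
        obtain ⟨ξ, hξ⟩ := exists_ordOf_eq (h4.trans (Ordinal.omega_lt_omega.2 one_lt_two))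
        have h5 : ξ < w₁ := ordOf_lt_ordOf.1 (by rwa [hξ, hw₁])
        exact ⟨ξ, h5, eq_of_treeHeight_eq (hchain B ht (hnd B ξ h5).1)
          (by rw [(hnd B ξ h5).2, hξ])⟩
      · rintro ⟨ξ, hξ, rfl⟩
        exact (hnd B ξ hξ).1
    refine Subtype.ext (Set.ext fun t => ?_)
    rw [h3 B, h3 B']
    exact exists_congr fun ξ => and_congr_right fun hξ => by rw [h2 ξ hξ]
  · intro _ s hs hlt'
    have : Countable s := hs.to_subtype
    have h1 : ⨆ ξ : s, Order.succ (ordOf ξ.1) < ω₁ := Ordinal.iSup_lt_omega_one fun ξ =>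
      (Cardinal.isSuccLimit_omega 1).succ_lt (hlt (hlt' _ ξ.2))
    obtain ⟨η, hη⟩ := exists_ordOf_eq (h1.trans (Ordinal.omega_lt_omega.2 one_lt_two))
    refine ⟨η, ordOf_lt_ordOf.1 (by rwa [hη, hw₁]), fun ξ hξ => ordOf_lt_ordOf.1 ?_⟩
    rw [hη]
    exact (Order.lt_succ _).trans_le
      (Ordinal.le_iSup (fun ξ : s => Order.succ (ordOf ξ.1)) ⟨ξ, hξ⟩)
  · exact fun B ξ hξ => if_neg (not_lt.2 hξ)
  · exact fun B β hβ => ⟨hβ, B, fun _ _ => rfl⟩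

/-! ### Limit points, closure points and stationary sets of ordinals below `ω₂` -/

/-- `β` is a limit of elements of `S` from below. -/
def LimPt {W : Type} [LinearOrder W] (β : W) (S : Set W) : Prop :=
  (∃ ξ, ξ < β) ∧ ∀ ξ < β, ∃ γ ∈ S, ξ < γ ∧ γ < β

/-- `δ` is a limit element. -/
def LimElt {W : Type} [LinearOrder W] (δ : W) : Prop :=
  (∃ ξ, ξ < δ) ∧ ∀ ξ < δ, ∃ ζ < δ, ξ < ζ

/-- `δ` is closed under `F`. -/
def ClosedUnder {W : Type} [LinearOrder W] (F : W → W) (δ : W) : Prop := ∀ ξ < δ, F ξ < δ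

/-- `S` contains a closure point of every function. -/
def MeetsClosurePoints {W : Type} [LinearOrder W] (S : Set W) : Prop :=
  ∀ F : W → W, ∃ δ ∈ S, ClosedUnder F δ

theorem mk_Iic_omegaTwo_le (i : OmegaTwo) : #(Set.Iic i) ≤ ℵ₁ := by
  obtain ⟨w, hw⟩ := exists_forall_lt_of_countable (Set.countable_singleton i)
  exact (Cardinal.mk_le_mk_of_subset fun x (hx : x ≤ i) => hx.trans_lt (hw i rfl)).trans
    (mk_Iio_omegaTwo_le w)

/-- Iterate a strictly increasing bound for `F` and take the supremum of the resulting `ω`-sequence.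
-/
theorem meetsClosurePoints_limElt : MeetsClosurePoints {δ : OmegaTwo | LimElt δ} := by
  intro F
  have hG : ∀ ξ : OmegaTwo, ∃ w, ξ < w ∧ ∀ ξ' ≤ ξ, F ξ' < w := by
    intro ξ
    obtain ⟨w, hw⟩ := exists_forall_lt_of_mk_le (F '' Set.Iic ξ)
      (Cardinal.mk_image_le.trans (mk_Iic_omegaTwo_le ξ))
    obtain ⟨w', hw'⟩ := exists_forall_lt_of_countable (Set.countable_singleton ξ)
    exact ⟨max w w', (hw' ξ rfl).trans_le (le_max_right _ _), fun ξ' h =>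
      (hw _ ⟨ξ', h, rfl⟩).trans_le (le_max_left _ _)⟩
  choose G hG1 hG2 using hG
  obtain ⟨w₀, -⟩ := exists_forall_lt_of_countable (Set.countable_empty (α := OmegaTwo))
  let a : ℕ → OmegaTwo := fun n => G^[n] w₀
  have ha : ∀ n, a (n + 1) = G (a n) := fun n => Function.iterate_succ_apply' G n w₀
  have hne : {w | ∀ x ∈ Set.range a, x < w}.Nonempty :=
    exists_forall_lt_of_countable (Set.countable_range a)
  have h1 : ∀ n, a n < wellFounded_lt.min _ hne := fun n =>
    WellFounded.min_mem wellFounded_lt _ hne _ ⟨n, rfl⟩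
  have h2 : ∀ ξ < wellFounded_lt.min _ hne, ∃ n, ξ ≤ a n := by
    intro ξ hξ
    by_contra! h
    refine hξ.not_ge (WellFounded.min_le wellFounded_lt
      (show ξ ∈ {w | ∀ x ∈ Set.range a, x < w} from ?_))
    rintro _ ⟨n, rfl⟩
    exact h n
  refine ⟨wellFounded_lt.min _ hne, ⟨⟨_, h1 0⟩, fun ξ hξ => ?_⟩, fun ξ hξ => ?_⟩
  · obtain ⟨n, hn⟩ := h2 ξ hξ
    exact ⟨a (n + 1), h1 _, hn.trans_lt (by rw [ha]; exact hG1 _)⟩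
  · obtain ⟨n, hn⟩ := h2 ξ hξ
    refine lt_trans ?_ (h1 (n + 1))
    rw [ha]
    exact hG2 _ _ hn

theorem exists_diagonal_bound (H : OmegaTwo → OmegaTwo → OmegaTwo) :
    ∃ F, ∀ δ, ClosedUnder F δ → ∀ i < δ, ClosedUnder (H i) δ := by
  have h : ∀ ξ : OmegaTwo, ∃ w, ∀ i ≤ ξ, ∀ ξ' ≤ ξ, H i ξ' < w := by
    intro ξ
    obtain ⟨w, hw⟩ := exists_forall_lt_of_mk_le
      ((fun p : OmegaTwo × OmegaTwo => H p.1 p.2) '' (Set.Iic ξ ×ˢ Set.Iic ξ)) (by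
        refine Cardinal.mk_image_le.trans ?_
        rw [Cardinal.mk_setProd]
        exact (mul_le_mul' (mk_Iic_omegaTwo_le ξ) (mk_Iic_omegaTwo_le ξ)).trans
          (Cardinal.mul_eq_self (Cardinal.aleph0_le_aleph 1)).le)
    exact ⟨w, fun i hi ξ' hξ' => hw _ ⟨(i, ξ'), ⟨hi, hξ'⟩, rfl⟩⟩
  choose F hF using h
  exact ⟨F, fun δ hδ i hi ξ hξ =>
    (hF (max i ξ) i (le_max_left _ _) ξ (le_max_right _ _)).trans (hδ _ (max_lt hi hξ))⟩

theorem exists_countable_bound (H : ℕ → OmegaTwo → OmegaTwo) :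
    ∃ F, ∀ δ, ClosedUnder F δ → ∀ n, ClosedUnder (H n) δ := by
  choose F hF using fun ξ : OmegaTwo =>
    exists_forall_lt_of_countable (Set.countable_range fun n => H n ξ)
  exact ⟨F, fun δ hδ n ξ hξ => (hF ξ _ ⟨n, rfl⟩).trans (hδ ξ hξ)⟩

/-- The pressing-down lemma. -/
theorem MeetsClosurePoints.exists_fiber {S : Set OmegaTwo} (hS : MeetsClosurePoints S)
    {e : OmegaTwo → OmegaTwo} (he : ∀ δ ∈ S, e δ < δ) :
    ∃ η, MeetsClosurePoints {δ | δ ∈ S ∧ e δ = η} := by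
  by_contra! h
  simp only [MeetsClosurePoints, not_forall, not_exists, not_and] at h
  choose H hH using h
  obtain ⟨F, hF⟩ := exists_diagonal_bound H
  obtain ⟨δ, hδ, hδF⟩ := hS F
  exact hH (e δ) δ ⟨hδ, rfl⟩ (hF δ hδF _ (he δ hδ))

theorem MeetsClosurePoints.exists_nat_fiber {S : Set OmegaTwo} (hS : MeetsClosurePoints S)
    (k : OmegaTwo → ℕ) : ∃ n, MeetsClosurePoints {δ | δ ∈ S ∧ k δ = n} := by
  by_contra! h
  simp only [MeetsClosurePoints, not_forall, not_exists, not_and] at h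
  choose H hH using h
  obtain ⟨F, hF⟩ := exists_countable_bound H
  obtain ⟨δ, hδ, hδF⟩ := hS F
  exact hH (k δ) δ ⟨hδ, rfl⟩ (hF δ hδF _)

/-- The least `α` with uncountably many elements between `w` and `α` works: a countable cofinal set
would make that interval a countable union of countable ones. -/
theorem exists_uncCof_gt (w : OmegaTwo) : ∃ α, w < α ∧ UncCof α := by
  have h1 : ℵ₁ ≤ #(Set.Ioi w) := by
    by_contra! h
    obtain ⟨v, hv⟩ := exists_forall_lt_of_mk_le _ h.le
    obtain ⟨u, hu⟩ := exists_forall_lt_of_countable (Set.countable_singleton w)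
    exact (hv v ((hu w rfl).trans (hv u (hu w rfl)))).false
  obtain ⟨p, hp, hpc⟩ := Cardinal.le_mk_iff_exists_subset.1 h1
  obtain ⟨v, hv⟩ := exists_forall_lt_of_mk_le p hpc.le
  have hne : {α | ¬ (Set.Ioo w α).Countable}.Nonempty := by
    refine ⟨v, fun hc => ?_⟩
    have h2 := Cardinal.le_aleph0_iff_set_countable.2
      (hc.mono fun x hx => show x ∈ Set.Ioo w v from ⟨hp hx, hv x hx⟩)
    rw [hpc] at h2
    exact Cardinal.aleph0_lt_aleph_one.not_ge h2
  have hα : ¬ (Set.Ioo w (wellFounded_lt.min _ hne)).Countable :=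
    WellFounded.min_mem wellFounded_lt _ hne
  have hlt : ∀ ξ < wellFounded_lt.min _ hne, (Set.Ioo w ξ).Countable := fun ξ hξ => by
    by_contra h2
    exact hξ.not_ge (WellFounded.min_le wellFounded_lt h2)
  refine ⟨wellFounded_lt.min _ hne, not_le.1 fun h2 => hα ?_, fun s hs hsl => ?_⟩
  · rw [Set.Ioo_eq_empty (not_lt.2 h2)]
    exact Set.countable_empty
  · by_contra! h2
    refine hα ((hs.biUnion fun ξ hξ => (hlt ξ (hsl ξ hξ)).insert ξ).mono fun x hx => ?_)
    obtain ⟨ξ, hξ, hle⟩ := h2 x hx.2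
    refine Set.mem_iUnion₂.2 ⟨ξ, hξ, ?_⟩
    rcases hle.eq_or_lt with rfl | h3
    · exact Set.mem_insert _ _
    · exact Set.mem_insert_of_mem _ ⟨hx.1, h3⟩

/-! ### Square sequences on `OmegaTwo` -/

/-- A `□(ω₂)`-sequence indexed by the well-ordered type `OmegaTwo`. -/
structure IsSquareSeq (c : OmegaTwo → Set OmegaTwo) : Prop where
  lt : ∀ α, ∀ γ ∈ c α, γ < α
  cofinal : ∀ α, ∀ ξ < α, ∃ γ ∈ c α, ξ ≤ γ
  closed : ∀ α, ∀ β < α, LimPt β (c α) → β ∈ c α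
  coherent : ∀ α, ∀ β < α, LimPt β (c α) → ∀ γ, γ ∈ c β ↔ γ ∈ c α ∧ γ < β
  nontrivial : ¬ ∃ D : Set OmegaTwo, (∀ ξ, ∃ γ ∈ D, ξ ≤ γ) ∧ (∀ β, LimPt β D → β ∈ D) ∧
    ∀ α, LimPt α D → ∀ γ, γ ∈ c α ↔ γ ∈ D ∧ γ < α

theorem limPt_preimage_ordOf {β : OmegaTwo} {S : Set Ordinal.{0}} :
    LimPt β (ordOf ⁻¹' S) ↔ AccPt (ordOf β) (Filter.principal S) := by
  rw [SuccOrder.accPt_principal]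
  refine and_congr ?_ ?_
  · rw [not_isMin_iff]
    constructor
    · rintro ⟨ξ, hξ⟩
      exact ⟨ordOf ξ, ordOf_lt_ordOf.2 hξ⟩
    · rintro ⟨o, ho⟩
      obtain ⟨ξ, rfl⟩ := exists_ordOf_eq (ho.trans (ordOf_lt_omega β))
      exact ⟨ξ, ordOf_lt_ordOf.1 ho⟩
  · constructor
    · intro h o ho
      obtain ⟨ξ, rfl⟩ := exists_ordOf_eq (ho.trans (ordOf_lt_omega β))
      obtain ⟨γ, h1, h2, h3⟩ := h ξ (ordOf_lt_ordOf.1 ho)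
      exact ⟨ordOf γ, h1, ordOf_lt_ordOf.2 h2, ordOf_lt_ordOf.2 h3⟩
    · intro h ξ hξ
      obtain ⟨o, h1, h2, h3⟩ := h _ (ordOf_lt_ordOf.2 hξ)
      obtain ⟨γ, rfl⟩ := exists_ordOf_eq (h3.trans (ordOf_lt_omega β))
      exact ⟨γ, h1, ordOf_lt_ordOf.1 h2, ordOf_lt_ordOf.1 h3⟩

theorem exists_isSquareSeq (h : TodorcevicSquare (ω_ 2 : Ordinal.{0})) :
    ∃ c, IsSquareSeq c := by
  obtain ⟨C, hclub, hcoh, hnt⟩ := h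
  refine ⟨fun α => ordOf ⁻¹' C (ordOf α), fun α γ hγ => ?_, fun α ξ hξ => ?_, fun α β hβ hlim => ?_,
    fun α β hβ hlim γ => ?_, ?_⟩
  · exact ordOf_lt_ordOf.1 ((hclub _ (ordOf_lt_omega α)).1 hγ)
  · obtain ⟨⟨o, ho⟩, h1, h2⟩ :=
      (hclub _ (ordOf_lt_omega α)).2.isCofinal ⟨ordOf ξ, ordOf_lt_ordOf.2 hξ⟩
    obtain ⟨γ, rfl⟩ := exists_ordOf_eq (lt_trans ho (ordOf_lt_omega α))
    exact ⟨γ, h1, ordOf_le_ordOf.1 h2⟩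
  · have h1 := (hclub _ (ordOf_lt_omega α)).2
    let t : Set (Set.Iio (ordOf α)) := {o | o.1 ∈ C (ordOf α) ∧ o.1 < ordOf β}
    obtain ⟨⟨ξ, hξ⟩, hlim'⟩ := hlim
    refine h1.isLUB_mem (t := t) (x := ⟨ordOf β, ordOf_lt_ordOf.2 hβ⟩) (fun o ho => ho.1) ?_
      ⟨fun o ho => ho.2.le, fun b hb => ?_⟩
    · obtain ⟨γ, h2, -, h4⟩ := hlim' ξ hξ
      exact ⟨⟨ordOf γ, ordOf_lt_ordOf.2 (h4.trans hβ)⟩, h2, ordOf_lt_ordOf.2 h4⟩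
    · by_contra h2
      obtain ⟨η, hη⟩ := exists_ordOf_eq (lt_trans b.2 (ordOf_lt_omega α))
      have h3 : ordOf η < ordOf β := by rw [hη]; exact not_le.1 h2
      obtain ⟨γ, h4, h5, h6⟩ := hlim' η (ordOf_lt_ordOf.1 h3)
      have h7 : ordOf γ ≤ b.1 :=
        hb (show (⟨ordOf γ, ordOf_lt_ordOf.2 (h6.trans hβ)⟩ : Set.Iio (ordOf α)) ∈ t from
          ⟨h4, ordOf_lt_ordOf.2 h6⟩)
      rw [← hη] at h7
      exact (ordOf_lt_ordOf.2 h5).not_ge h7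
  · have := hcoh _ (ordOf_lt_omega α) _ (ordOf_lt_ordOf.2 hβ) (limPt_preimage_ordOf.1 hlim)
    show ordOf γ ∈ C (ordOf β) ↔ _
    rw [this]
    exact and_congr_right fun _ => ordOf_lt_ordOf
  · rintro ⟨D, hD1, hD2, hD3⟩
    have hD : ordOf ⁻¹' (ordOf '' D) = D := Set.preimage_image_eq D ordOf_injective
    refine hnt ⟨ordOf '' D, ⟨?_, ⟨?_, ?_⟩⟩, ?_⟩
    · rintro _ ⟨γ, -, rfl⟩
      exact ordOf_lt_omega γ
    · intro t ht hne _ x hx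
      by_cases hxt : x ∈ t
      · exact ht hxt
      · obtain ⟨β, hβ⟩ := exists_ordOf_eq x.2
        refine ⟨β, hD2 β ⟨?_, fun ξ hξ => ?_⟩, hβ⟩
        · obtain ⟨y, hy⟩ := hne
          have hyx : y < x := lt_of_le_of_ne (hx.1 hy) fun h => hxt (h ▸ hy)
          obtain ⟨ξ, hξ⟩ := exists_ordOf_eq y.2
          exact ⟨ξ, ordOf_lt_ordOf.1 (by rw [hξ, hβ]; exact hyx)⟩
        · have h1 : (⟨ordOf ξ, ordOf_lt_omega ξ⟩ : Set.Iio (ω_ 2 : Ordinal.{0})) < x := by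
            show ordOf ξ < x.1
            rw [← hβ]
            exact ordOf_lt_ordOf.2 hξ
          obtain ⟨y, hy, hξy⟩ := (lt_isLUB_iff hx).1 h1
          have hyx : y < x := lt_of_le_of_ne (hx.1 hy) fun h => hxt (h ▸ hy)
          obtain ⟨γ, hγ, hγy⟩ := ht hy
          refine ⟨γ, hγ, ordOf_lt_ordOf.1 ?_, ordOf_lt_ordOf.1 ?_⟩
          · rw [hγy]; exact hξy
          · rw [hγy, hβ]; exact hyx
    · rintro ⟨o, ho⟩
      obtain ⟨ξ, rfl⟩ := exists_ordOf_eq ho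
      obtain ⟨γ, h1, h2⟩ := hD1 ξ
      exact ⟨⟨ordOf γ, ordOf_lt_omega γ⟩, ⟨γ, h1, rfl⟩, ordOf_le_ordOf.2 h2⟩
    · intro o ho hacc
      obtain ⟨α, rfl⟩ := exists_ordOf_eq ho
      have h1 := hD3 α (by rw [← hD]; exact limPt_preimage_ordOf.2 hacc)
      ext o'
      constructor
      · rintro ⟨⟨γ, hγ, rfl⟩, h2⟩
        exact (h1 γ).2 ⟨hγ, ordOf_lt_ordOf.1 h2⟩
      · intro h2
        have h3 : o' < ordOf α := (hclub _ ho).1 h2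
        obtain ⟨γ, rfl⟩ := exists_ordOf_eq (h3.trans ho)
        exact ⟨⟨γ, ((h1 γ).1 h2).1, rfl⟩, h3⟩

/-! ### Walks along a square sequence -/

open Classical in
/-- The number of steps of the walk from `α` down to `ξ` along `c`. -/
noncomputable def walk (c : OmegaTwo → Set OmegaTwo) (ξ α : OmegaTwo) : ℕ :=
  if h : {γ | γ ∈ c α ∧ ξ ≤ γ ∧ γ < α}.Nonempty then
    walk c ξ (wellFounded_lt.min _ h) + 1 else 0
termination_by α
decreasing_by exact (WellFounded.min_mem wellFounded_lt _ h).2.2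

namespace IsSquareSeq

variable {c : OmegaTwo → Set OmegaTwo}

theorem walk_eq (hc : IsSquareSeq c) {ξ α γ : OmegaTwo} (h1 : γ ∈ c α) (h2 : ξ ≤ γ)
    (h3 : ∀ γ' ∈ c α, ξ ≤ γ' → γ ≤ γ') : walk c ξ α = walk c ξ γ + 1 := by
  have h : {γ | γ ∈ c α ∧ ξ ≤ γ ∧ γ < α}.Nonempty := ⟨γ, h1, h2, hc.lt _ _ h1⟩
  have h4 : wellFounded_lt.min _ h = γ := le_antisymm
    (WellFounded.min_le wellFounded_lt
      (show γ ∈ {γ | γ ∈ c α ∧ ξ ≤ γ ∧ γ < α} from ⟨h1, h2, hc.lt _ _ h1⟩))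
    (h3 _ (WellFounded.min_mem wellFounded_lt _ h).1 (WellFounded.min_mem wellFounded_lt _ h).2.1)
  rw [walk, dif_pos h, h4]

theorem exists_min (hc : IsSquareSeq c) {ξ α : OmegaTwo} (h : ξ < α) :
    ∃ γ ∈ c α, ξ ≤ γ ∧ ∀ γ' ∈ c α, ξ ≤ γ' → γ ≤ γ' := by
  have hne : {γ | γ ∈ c α ∧ ξ ≤ γ}.Nonempty := hc.cofinal α ξ h
  obtain ⟨h1, h2⟩ := WellFounded.min_mem wellFounded_lt _ hne
  exact ⟨_, h1, h2, fun γ' h3 h4 => WellFounded.min_le wellFounded_lt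
    (show γ' ∈ {γ | γ ∈ c α ∧ ξ ≤ γ} from ⟨h3, h4⟩)⟩

/-- Since `c δ` is `c α` cut at `δ`, the walks from `α` and from `δ` have the same first step. -/
theorem walk_eq_of_limPt (hc : IsSquareSeq c) {ξ δ α : OmegaTwo} (hδ : δ < α)
    (hlim : LimPt δ (c α)) (hξ : ξ < δ) :
    walk c ξ α = walk c ξ δ := by
  obtain ⟨γ, h1, h2, h3⟩ := hc.exists_min hξ
  have hcoh := hc.coherent α δ hδ hlim
  rw [hc.walk_eq h1 h2 h3]
  refine hc.walk_eq ((hcoh γ).1 h1).1 h2 fun γ' h4 h5 => ?_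
  rcases lt_or_ge γ' δ with h6 | h6
  · exact h3 γ' ((hcoh γ').2 ⟨h4, h6⟩) h5
  · exact (hc.lt _ _ h1).le.trans h6

/-- If `c α` is bounded below `δ`, all walks to places late below `δ` first step to the minimum of
`c α` above or at `δ`; then induct. That the difference is positive is what defeats a cofinal
branch. -/
theorem walk_coherent (hc : IsSquareSeq c) {δ α : OmegaTwo} (hδ : LimElt δ) (h : δ < α) :
    LimPt δ (c α) ∨
      ∃ k, ∃ η < δ, ∀ ξ, η ≤ ξ → ξ < δ → walk c ξ α = walk c ξ δ + (k + 1) := by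
  induction α using WellFoundedLT.induction with
  | _ α ih =>
    by_cases hlim : LimPt δ (c α)
    · exact Or.inl hlim
    right
    obtain ⟨η, hη, hη'⟩ : ∃ η < δ, ∀ γ ∈ c α, η < γ → δ ≤ γ := by
      simpa [LimPt, hδ.1] using hlim
    obtain ⟨η', hη'δ, hηη'⟩ := hδ.2 η hη
    obtain ⟨γ, h1, h2, h3⟩ := hc.exists_min h
    have h4 : ∀ ξ, η' ≤ ξ → ξ < δ → walk c ξ α = walk c ξ γ + 1 := fun ξ h5 h6 =>
      hc.walk_eq h1 (h6.le.trans h2) fun γ' h7 h8 =>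
        h3 γ' h7 (hη' γ' h7 (hηη'.trans_le (h5.trans h8)))
    rcases h2.eq_or_lt with rfl | h5
    · exact ⟨0, η', hη'δ, h4⟩
    rcases ih γ (hc.lt _ _ h1) h5 with h6 | ⟨k, ζ, hζ, h6⟩
    · exact ⟨0, η', hη'δ, fun ξ h7 h8 => by rw [h4 ξ h7 h8, hc.walk_eq_of_limPt h5 h6 h8]⟩
    · refine ⟨k + 1, max η' ζ, max_lt hη'δ hζ, fun ξ h7 h8 => ?_⟩
      rw [h4 ξ ((le_max_left _ _).trans h7) h8, h6 ξ ((le_max_right _ _).trans h7) h8]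
      ring

theorem exists_walk_add (hc : IsSquareSeq c) {δ α : OmegaTwo} (hδ : LimElt δ) (h : δ ≤ α) :
    ∃ k, ∃ η < δ, ∀ ξ, η ≤ ξ → ξ < δ → walk c ξ α = walk c ξ δ + k := by
  obtain ⟨ξ₀, hξ₀⟩ := hδ.1
  rcases h.eq_or_lt with rfl | h
  · exact ⟨0, ξ₀, hξ₀, fun _ _ _ => rfl⟩
  rcases hc.walk_coherent hδ h with h1 | ⟨k, η, hη, h1⟩
  · exact ⟨0, ξ₀, hξ₀, fun ξ _ h2 => hc.walk_eq_of_limPt h h1 h2⟩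
  · exact ⟨k + 1, η, hη, h1⟩

/-- The tree of walk functions has no cofinal branch. -/
theorem not_exists_cofinal_branch (hc : IsSquareSeq c) :
    ¬ ∃ f : OmegaTwo → ℕ, ∀ β, ∃ α, β ≤ α ∧ ∀ ξ < β, walk c ξ α = f ξ := by
  rintro ⟨f, hf⟩
  have h0 : ∀ δ : OmegaTwo, ∃ k : ℕ, ∃ η : OmegaTwo, LimElt δ →
      η < δ ∧ ∀ ξ, η ≤ ξ → ξ < δ → f ξ = walk c ξ δ + k := by
    intro δ
    by_cases hδ : LimElt δ
    · obtain ⟨α, h1, h2⟩ := hf δ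
      obtain ⟨k, η, h3, h4⟩ := hc.exists_walk_add hδ h1
      exact ⟨k, η, fun _ => ⟨h3, fun ξ h5 h6 => by rw [← h2 ξ h6, h4 ξ h5 h6]⟩⟩
    · exact ⟨0, δ, fun h => absurd h hδ⟩
  choose k e hke using h0
  let S : ℕ → Set OmegaTwo := fun n => {δ | δ ∈ {δ | LimElt δ} ∧ k δ = n}
  -- A value taken cofinally bounds every offset `k δ` that occurs stationarily often, so a largest
  -- such offset `n` exists.
  obtain ⟨m, hm⟩ : ∃ m, ∀ ξ, ∃ ξ', ξ ≤ ξ' ∧ f ξ' = m := by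
    by_contra! h
    choose b hb using h
    obtain ⟨w, hw⟩ := exists_forall_lt_of_countable (Set.countable_range b)
    exact hb (f w) w (hw _ ⟨_, rfl⟩).le rfl
  have hbdd : ∀ n, MeetsClosurePoints (S n) → n ≤ m := by
    intro n hn
    choose F hF1 hF2 using hm
    obtain ⟨δ, ⟨hδ, hkδ⟩, hδF⟩ := hn F
    have h1 := (hke δ hδ).2 _ (hF1 (e δ)) (hδF _ (hke δ hδ).1)
    rw [hF2, hkδ] at h1
    omega
  obtain ⟨n, hn, hmax⟩ : ∃ n, MeetsClosurePoints (S n) ∧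
      ∀ n', n < n' → ¬ MeetsClosurePoints (S n') := by
    have hne : {n | MeetsClosurePoints (S n)}.Nonempty :=
      meetsClosurePoints_limElt.exists_nat_fiber k
    have hba : BddAbove {n | MeetsClosurePoints (S n)} := ⟨m, hbdd⟩
    exact ⟨_, Nat.sSup_mem hne hba, fun n' h1 h2 => h1.not_ge (le_csSup hba h2)⟩
  obtain ⟨F₀, hF₀⟩ : ∃ F₀, ∀ ε, LimElt ε → ClosedUnder F₀ ε → k ε ≤ n := by
    have h1 : ∀ n', ∃ H : OmegaTwo → OmegaTwo, n < n' → ∀ δ ∈ S n', ¬ ClosedUnder H δ := by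
      intro n'
      by_cases h : n < n'
      · obtain ⟨H, hH⟩ := not_forall.1 (hmax n' h)
        exact ⟨H, fun _ δ h2 h3 => hH ⟨δ, h2, h3⟩⟩
      · exact ⟨id, fun h2 => absurd h2 h⟩
    choose H hH using h1
    obtain ⟨F, hF⟩ := exists_countable_bound H
    exact ⟨F, fun ε h2 h3 => not_lt.1 fun h4 => hH _ h4 ε ⟨h2, rfl⟩ (hF ε h3 _)⟩
  obtain ⟨η, hη⟩ := hn.exists_fiber (e := e) fun δ hδ => (hke δ hδ.1).1
  let E : Set OmegaTwo := {ε | LimElt ε ∧ ClosedUnder F₀ ε ∧ η < ε}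
  have hE : ∀ w, ∃ ε ∈ E, w < ε := by
    intro w
    obtain ⟨ε, h1, h2⟩ := meetsClosurePoints_limElt fun ξ => max (F₀ ξ) (max η w)
    obtain ⟨ξ, hξ⟩ := h1.1
    have h3 := h2 ξ hξ
    simp only [max_lt_iff] at h3
    exact ⟨ε, ⟨h1, fun ξ' h => (le_max_left _ _).trans_lt (h2 ξ' h), h3.2.1⟩, h3.2.2⟩
  -- Otherwise the walk from `δ` exceeds that from `ε` by `j + 1`, giving offset `k ε = n + j + 1`,
  -- against the maximality of `n`.
  have hlim : ∀ ε ∈ E, ∀ δ ∈ S n, e δ = η → ε < δ → LimPt ε (c δ) := by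
    rintro ε ⟨h1, h2, h3⟩ δ hδ heδ hεδ
    rcases hc.walk_coherent h1 hεδ with h4 | ⟨j, ζ, hζ, h4⟩
    · exact h4
    · exfalso
      have h5 := hke ε h1
      have hx : max (max η ζ) (e ε) < ε := max_lt (max_lt h3 hζ) h5.1
      have h6 := h5.2 _ (le_max_right _ _) hx
      have h7 := (hke δ hδ.1).2 (max (max η ζ) (e ε))
        (by rw [heδ]; exact (le_max_left _ _).trans (le_max_left _ _)) (hx.trans hεδ)
      have h8 := h4 _ ((le_max_right _ _).trans (le_max_left _ _)) hx
      have h9 := hF₀ ε h1 h2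
      have h10 := hδ.2
      omega
  have hD : ∀ ε ∈ E, ∀ γ < ε, (∃ ε' ∈ E, γ ∈ c ε') ↔ γ ∈ c ε := by
    refine fun ε hε γ hγ => ⟨?_, fun h => ⟨ε, hε, h⟩⟩
    rintro ⟨ε', hε', h⟩
    obtain ⟨δ, ⟨hδ, heδ⟩, h1⟩ := hη fun _ => max ε ε'
    obtain ⟨ξ, hξ⟩ := hδ.1.1
    obtain ⟨h2, h3⟩ := max_lt_iff.1 (h1 ξ hξ)
    exact (hc.coherent δ ε h2 (hlim ε hε δ hδ heδ h2) γ).2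
      ⟨((hc.coherent δ ε' h3 (hlim ε' hε' δ hδ heδ h3) γ).1 h).1, hγ⟩
  have hD' : ∀ ε ∈ E, ∀ β < ε, LimPt β {γ | ∃ ε' ∈ E, γ ∈ c ε'} → LimPt β (c ε) := by
    refine fun ε hε β hβ h => ⟨h.1, fun ξ hξ => ?_⟩
    obtain ⟨γ, h1, h2, h3⟩ := h.2 ξ hξ
    exact ⟨γ, (hD ε hε γ (h3.trans hβ)).1 h1, h2, h3⟩
  -- The sets `c ε` for `ε ∈ E` cohere through common larger `δ`, so their union is a club threading
  -- the square sequence.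
  refine hc.nontrivial ⟨{γ | ∃ ε ∈ E, γ ∈ c ε}, fun ξ => ?_, fun β hβ => ?_, fun α hα γ => ?_⟩
  · obtain ⟨ε, hε, h1⟩ := hE ξ
    obtain ⟨γ, h2, h3⟩ := hc.cofinal ε ξ h1
    exact ⟨γ, ⟨ε, hε, h2⟩, h3⟩
  · obtain ⟨ε, hε, h1⟩ := hE β
    exact ⟨ε, hε, hc.closed ε β h1 (hD' ε hε β h1 hβ)⟩
  · obtain ⟨ε, hε, h1⟩ := hE α
    rw [hc.coherent ε α h1 (hD' ε hε α h1 hα)]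
    exact and_congr_left fun h2 => (hD ε hε γ (h2.trans h1)).symm

/-- At limits, the walk function from `δ` plus a natural number represents every node eventually; at
successors only the last value matters. -/
theorem isThin_walk (hc : IsSquareSeq c) :
    TreeData.IsThin fun β (h : OmegaTwo → ℕ) => ∃ α, β ≤ α ∧ ∀ ξ < β, walk c ξ α = h ξ := by
  intro δ hδ
  by_cases hlim : LimElt δ
  · refine ⟨Set.range fun (k : ℕ) ξ => walk c ξ δ + k, Set.countable_range _, ?_⟩
    rintro h ⟨α, h1, h2⟩
    obtain ⟨k, η, hη, h3⟩ := hc.exists_walk_add hlim h1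
    exact ⟨_, ⟨k, rfl⟩, η, hη, fun ξ h4 h5 => by rw [← h2 ξ h5, h3 ξ h4 h5]⟩
  · obtain ⟨η, hη, h1⟩ : ∃ η < δ, ∀ ξ < δ, ξ ≤ η := by
      simpa [LimElt, hδ] using hlim
    refine ⟨Set.range fun (k : ℕ) _ => k, Set.countable_range _, fun h _ => ?_⟩
    exact ⟨_, ⟨h η, rfl⟩, η, hη, fun ξ h2 h3 => by rw [le_antisymm (h1 ξ h3) h2]⟩

end IsSquareSeq

theorem aleph_one_lt_mk_uncCof : ℵ₁ < #{α : OmegaTwo // UncCof α} := by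
  by_contra! h
  obtain ⟨w, hw⟩ := exists_forall_lt_of_mk_le {α | UncCof α} h
  obtain ⟨α, h1, h2⟩ := exists_uncCof_gt w
  exact (hw α h2).not_gt h1

open Classical in
theorem exists_spaces_of_square (hCH : (2 : Cardinal.{0}) ^ ℵ₀ = ℵ₁)
    (h : TodorcevicSquare (ω_ 2 : Ordinal.{0})) :
    ∃ (X₀ X₁ : Type) (_ : TopologicalSpace X₀) (_ : TopologicalSpace X₁),
      (RegularSpace X₀ ∧ T1Space X₀ ∧ LindelofSpace X₀ ∧ ∀ x : X₀, IsGδ ({x} : Set X₀)) ∧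
      (RegularSpace X₁ ∧ T1Space X₁ ∧ LindelofSpace X₁ ∧ ∀ x : X₁, IsGδ ({x} : Set X₁)) ∧
      (2 : Cardinal.{0}) ^ ℵ₀ < extent (X₀ × X₁) := by
  obtain ⟨c, hc⟩ := exists_isSquareSeq h
  refine TreeData.exists_spaces hCH
    (Ext := fun β h => ∃ α, β ≤ α ∧ ∀ ξ < β, walk c ξ α = h ξ) ?_ ?_
    hc.not_exists_cofinal_branch hc.isThin_walk aleph_one_lt_mk_uncCof
    (fun α => (α.1, fun ξ => if ξ < α.1 then walk c ξ α.1 else 0)) ?_ (fun α => α.2) ?_ ?_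
  · rintro β g g' ⟨α, h1, h2⟩ hg
    exact ⟨α, h1, fun ξ hξ => (h2 ξ hξ).trans (hg ξ hξ)⟩
  · rintro β β' g hβ ⟨α, h1, h2⟩
    exact ⟨α, hβ.trans h1, fun ξ hξ => h2 ξ (hξ.trans_le hβ)⟩
  · exact fun α α' hα => Subtype.ext (Prod.mk.inj hα).1
  · exact fun α ξ hξ => if_neg (not_lt.2 hξ)
  · exact fun α β hβ => ⟨α.1, hβ.le, fun ξ hξ => (if_pos (hξ.trans hβ)).symm⟩

/-! ### The main theorem -/

theorem theorem1p1
    (hCH : (2 : Cardinal.{0}) ^ ℵ₀ = ℵ₁)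
    (h : (∃ (T : Type) (_ : PartialOrder T) (_ : IsSetTree T), IsKurepaTree T) ∨
      TodorcevicSquare (ω_ 2 : Ordinal.{0})) :
    ∃ (X₀ X₁ : Type) (_ : TopologicalSpace X₀) (_ : TopologicalSpace X₁),
      (RegularSpace X₀ ∧ T1Space X₀ ∧ LindelofSpace X₀ ∧ ∀ x : X₀, IsGδ ({x} : Set X₀)) ∧
      (RegularSpace X₁ ∧ T1Space X₁ ∧ LindelofSpace X₁ ∧ ∀ x : X₁, IsGδ ({x} : Set X₁)) ∧
      (2 : Cardinal.{0}) ^ ℵ₀ < extent (X₀ × X₁) := by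
  rcases h with ⟨T, _, _, hT⟩ | hsq
  · exact exists_spaces_of_kurepa hCH hT
  · exact exists_spaces_of_square hCH hsq
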